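/- Let $G:\mathbb{R}\to[0,\infty)$ be even, strictly increasing and convex on $[0,\infty)$, with $G(0)=0$ and $G(y)/G(x)\le C_G\,(y/x)^2$ for all $0<x<y$, where $C_G$ is a constant. For a vector $v\neq 0$ with positive coordinate weights $w$, let $\|v\|_{G,w}$ be the unique $\alpha>0$ with $\sum_i w_i\,G(|v_i|/\alpha)=1$, and put $\|0\|_{G,w}=0$; write $\|v\|_G$ if all weights are $1$. For a matrix $\mathbf M$ whose rows carry weights $w$, $\|\mathbf M\mathbf x\|_G$ means $\|\mathbf M\mathbf x\|_{G,w}$. The condition number of a matrix is the ratio of its largest singular value to its smallest nonzero singular value (no condition is imposed on a zero matrix); a stream of rows has condition number at most $\kappa$ if every matrix formed by consecutive rows of it does. For a real matrix $\mathbf A$ with $d$ columns and $\epsilon>0$, say that $\Delta$ is an aspect bound for $(\mathbf A,\epsilon)$ if there are a greedily constructed $\epsilon$-net $\mathcal N$ of the unit sphere $\{\mathbf x:\|\mathbf A\mathbf x\|_G=1\}$ (a subset whose points have pairwise distance at least $\epsilon$, and such that every point of the sphere is within distance $\epsilon$ of one of them, where $\mathbf x,\mathbf y$ have distance $\|\mathbf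 A(\mathbf x-\mathbf y)\|_G$) and reals $0<\Delta_1\le\Delta_2$ such that $\Delta_1\le|\langle\mathbf a,\mathbf x\rangle|\le\Delta_2$ for all $\mathbf x\in\mathcal N$ and all rows $\mathbf a$ of $\mathbf A$ with $\langle\mathbf a,\mathbf x\rangle\ne0$, and $\Delta\ge\frac{G(\Delta_2)\,\Delta_1}{G(\Delta_1)\,\Delta_2}$. A randomized row-sampling algorithm keeps in memory a finite set of rows of the stream, each with its arrival time and a positive weight. When a row arrives, it uses fresh randomness, the memory, the time and the arriving row to choose the new memory, which may contain only rows that were in memory and the arriving row; weights may be changed. It does not know the length of the stream in advance. **Theorem.** For all constants $C_G$ and integers $b,c\ge 0$ there is a constant $K>0$ such that the following holds. Let $n\ge2$, $d\ge0$ and $W\ge1$ be integers, let $\epsilon>0$, $\kappa\ge2$ and $\Delta$ be real, and let $G$ be as above with constant $C_G$. There is a randomized row-sampling algorithm such that for every stream $\mathbf r_1,\dots,\mathbf r_m\in\mathbb{Z}^d$ of $m\le n$ rows with entries at most $n^b$ in absolute value and with condition number at most $\kappa$, for which $\Delta$ is an aspect bound for $(\mathbf A,\epsilon)$, where $\mathbf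 A$ is the matrix of the $W$ most recent rows of the stream (of all the rows, if $m<W$), with probability at least $1-n^{-c}$ both of the following hold: 1. the number of rows in memory is at all times at most $K\cdot\frac{d^2\Delta}{\epsilon^2}\log^5 n\,\log\kappa$; 2. the matrix $\mathbf M$ of the weighted rows that are in memory at the end of the stream and belong to the window is a $(1+\epsilon)$ subspace embedding of $\mathbf A$, that is, $\bigl|\,\|\mathbf M\mathbf x\|_G-\|\mathbf A\mathbf x\|_G\bigr|\le\epsilon\|\mathbf A\mathbf x\|_G$ for all $\mathbf x\in\mathbb{R}^d$. -/

import Mathlib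

open Matrix

/-- The standing assumptions on the function `G` defining an Orlicz norm: `G` is strictly increasing
and convex on `[0, ∞)`, vanishes at `0`, is even, and grows at most quadratically with constant `C`. -/
structure IsOrliczFunction (G : ℝ → ℝ) (C : ℝ) : Prop where
  strictMonoOn : StrictMonoOn G (Set.Ici 0)
  convexOn : ConvexOn ℝ (Set.Ici 0) G
  map_zero : G 0 = 0
  even : ∀ x, G (-x) = G x
  growth : ∀ x y : ℝ, 0 < x → x < y → G y / G x ≤ C * (y / x) ^ 2

/-- The Orlicz norm `‖v‖_G`: the unique `α > 0` with `∑ i, G (|v i| / α) = 1` if `v ≠ 0`. For `v = 0`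
no such `α` exists (as `G 0 = 0`), and the value is `sInf ∅ = 0`. -/
noncomputable def orliczNorm {ι : Type*} [Fintype ι] (G : ℝ → ℝ) (v : ι → ℝ) : ℝ :=
  sInf {α : ℝ | 0 < α ∧ ∑ i, G (|v i| / α) = 1}

/-- The Orlicz norm of a vector whose coordinates carry weights `w`: the `i`-th coordinate counts
`w i` times. It is `orliczNorm` if all weights are `1`. -/
noncomputable def weightedOrliczNorm {ι : Type*} [Fintype ι] (G : ℝ → ℝ) (w v : ι → ℝ) : ℝ :=
  sInf {α : ℝ | 0 < α ∧ ∑ i, w i * G (|v i| / α) = 1}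

/-- The ratio of the largest singular value to the smallest nonzero singular value. (Mathlib lists the
singular values, indexed from `0`, in decreasing order; exactly the first `A.rank` are nonzero. For
`A = 0` the value is `0 / 0 = 0`.) -/
noncomputable def conditionNumber {ι : Type*} [Fintype ι] {d : ℕ} (A : Matrix ι (Fin d) ℝ) : ℝ :=
  (Matrix.toEuclideanLin (𝕜 := ℝ) A).singularValues 0 /
    (Matrix.toEuclideanLin (𝕜 := ℝ) A).singularValues (A.rank - 1)

/-- The matrix formed by the consecutive rows `r i, …, r (j - 1)` of a stream of rows. -/
def rowBlock {d : ℕ} (r : ℕ → Fin d → ℤ) (i j : ℕ) : Matrix (Finset.Ico i j) (Fin d) ℝ :=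
  Matrix.of fun t k => (r t k : ℝ)

/-- The matrix of the `W` most recent rows after the arrival of `r 0, …, r (m - 1)` (of all the rows,
if `m < W`). -/
abbrev windowMatrix {d : ℕ} (r : ℕ → Fin d → ℤ) (W m : ℕ) :
    Matrix (Finset.Ico (m - W) m) (Fin d) ℝ :=
  rowBlock r (m - W) m

/-- The stream `r 0, …, r (m - 1)` has condition number at most `κ`: so has every matrix formed by
consecutive rows. -/
def StreamConditionNumberLE {d : ℕ} (r : ℕ → Fin d → ℤ) (m : ℕ) (κ : ℝ) : Prop :=
  ∀ i j : ℕ, i < j → j ≤ m → conditionNumber (rowBlock r i j) ≤ κ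

/-- `N` is a greedily constructed `ε`-net of the unit sphere `{A x : ‖A x‖_G = 1}`, given by
coefficient vectors `x`: its points are `ε`-separated and every unit vector is within `ε` of one. -/
structure IsGreedyNet {ι : Type*} [Fintype ι] {d : ℕ} (G : ℝ → ℝ) (A : Matrix ι (Fin d) ℝ) (ε : ℝ)
    (N : Set (Fin d → ℝ)) : Prop where
  norm_eq_one : ∀ x ∈ N, orliczNorm G (A *ᵥ x) = 1
  separated : ∀ x ∈ N, ∀ y ∈ N, x ≠ y → ε ≤ orliczNorm G (A *ᵥ (x - y))
  covering : ∀ z, orliczNorm G (A *ᵥ z) = 1 → ∃ y ∈ N, orliczNorm G (A *ᵥ (z - y)) ≤ ε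

/-- `Δ` bounds the aspect ratio of the rows of `A` under `G`: on some greedily constructed `ε`-net the
nonzero values `|⟨a_i, x⟩|` lie in `[Δ₁, Δ₂]`, and `Δ ≥ (G Δ₂ / Δ₂) / (G Δ₁ / Δ₁)`. -/
def IsAspectBound {ι : Type*} [Fintype ι] {d : ℕ} (G : ℝ → ℝ) (A : Matrix ι (Fin d) ℝ)
    (ε Δ : ℝ) : Prop :=
  ∃ (N : Set (Fin d → ℝ)) (Δ₁ Δ₂ : ℝ), IsGreedyNet G A ε N ∧ 0 < Δ₁ ∧ Δ₁ ≤ Δ₂ ∧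
    (∀ x ∈ N, ∀ i, (A *ᵥ x) i ≠ 0 → Δ₁ ≤ |(A *ᵥ x) i| ∧ |(A *ᵥ x) i| ≤ Δ₂) ∧
    (G Δ₂ * Δ₁) / (G Δ₁ * Δ₂) ≤ Δ

/-- A row of the stream held in memory, with its arrival time and its current weight. -/
structure SampledRow (d : ℕ) where
  time : ℕ
  row : Fin d → ℤ
  weight : ℝ

/-- The memory of a row-sampling algorithm: a finite set of weighted rows of the stream. -/
abbrev Memory (d : ℕ) := Finset (SampledRow d)

/-- A randomized row-sampling algorithm. When the row `a` arrives at time `t` and the memory is `S`, the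
new memory is drawn, with fresh randomness, from `step t S a`. It may hold nothing but rows that were
in `S` and the arriving row, with positive weights, which may be changed. Rows that are dropped
cannot be recovered, and the length of the stream is not available to the algorithm. -/
structure RowSampler (d : ℕ) where
  step : ℕ → Memory d → (Fin d → ℤ) → PMF (Memory d)
  step_spec : ∀ t S a, ∀ S' ∈ (step t S a).support, ∀ s ∈ S', 0 < s.weight ∧
    ((s.time = t ∧ s.row = a) ∨ ∃ s₀ ∈ S, s₀.time = s.time ∧ s₀.row = s.row)

/-- The joint law of the memory after the arrival of `r 0, …, r (m - 1)` and of the largest number of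
rows held in memory up to then. -/
noncomputable def RowSampler.run {d : ℕ} (alg : RowSampler d) (r : ℕ → Fin d → ℤ) :
    ℕ → PMF (Memory d × ℕ)
  | 0 => PMF.pure (∅, 0)
  | m + 1 => (alg.run r m).bind fun p =>
      (alg.step m p.1 (r m)).map fun S => (S, max p.2 S.card)

/-- The output after `m` rows: the stored rows that lie in the current window. -/
def output {d : ℕ} (W m : ℕ) (S : Memory d) : Memory d :=
  S.filter fun s => m ≤ s.time + W

/-- The Orlicz norm `‖M x‖_G` for the matrix `M` of the weighted rows in `S`. -/
noncomputable def sampleNorm {d : ℕ} (G : ℝ → ℝ) (S : Memory d) (x : Fin d → ℝ) : ℝ :=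
  weightedOrliczNorm G (fun s : S => s.1.weight) fun s : S => ∑ k, (s.1.row k : ℝ) * x k

/-- The weighted rows in `S` are a `(1 + ε)` subspace embedding of `A` for the Orlicz norm of `G`. -/
def IsSubspaceEmbedding {ι : Type*} [Fintype ι] {d : ℕ} (G : ℝ → ℝ) (ε : ℝ) (S : Memory d)
    (A : Matrix ι (Fin d) ℝ) : Prop :=
  ∀ x : Fin d → ℝ,
    |sampleNorm G S x - orliczNorm G (A *ᵥ x)| ≤ ε * orliczNorm G (A *ᵥ x)

/-! The sampler is importance sampling run backwards in time. Row `i` is judged only against the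
rows after it, by the sensitivity `σ_i(t) = sup G⟨r_i, x⟩` over all `x` with `∑_{i ≤ j < t} G⟨r_j,
x⟩ ≤ 1`. This quantity can only fall as `t` grows, so a row can be discarded gradually: its weight
`w` is raised to some `w' ≥ w` and the row survives with probability `w / w'`, which keeps the
expected weight constant. The target weight is `γ / (σ + 1/n)`, with `σ` estimated from the stored
rows. Since earlier rows play no role, the sample approximates all suffixes `r_i, …, r_{t-1}`
simultaneously. The window is one of these suffixes, and the sampler does not depend on `W`.

Memory is governed by the total sensitivity (`sum_blockSens_le`), which is `O(d log n (log n + log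
κ))`. For each threshold `σ` the rows of sensitivity above `σ` have witnesses `x_i`. Quadratic
growth of `G` bounds the conflicts of `x_i` with later rows by `1/σ`, and a greedy colouring with
about `2/σ` colours makes them at most `1/2` inside a class. There, in reverse order, each row
multiplies the determinant of a ridge Gram matrix by at least `1 + 1/(2C)`. Integrality and the
condition number allow a ridge that is polynomially small in `1/(nκ)`, so a class has `O(d log(nκ))`
rows. Summing over dyadic thresholds costs one more logarithm.

Accuracy is circular, because the sampling probabilities depend on a memory that must itself be
accurate. Therefore expectations are taken over the runs that have been accurate so far
(`killedExp`). On these runs the weights are calibrated deterministically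
(`Memory.Calibrated.nextMemory`), and product potentials `∏ (1 + c w)` have controlled expectation
(`killedExp_prodPotential_le`). They dominate the exponential moments of the sampled modular at a
fixed vector and of the number of stored rows. A union bound over times, suffixes and the points of
an `ε/4`-net of each unit sphere bounds the probability of a first failure, and an estimate on a net
extends to the whole space because both norms are seminorms.

Finally `G x / x` is nondecreasing, so every aspect bound satisfies `Δ ≥ 1`, and a memory bound
without `Δ` suffices. The regimes `ε ≥ 1`, `d = 0` and `n ≤ d² / min(ε, 1/2)²` are settled by
storing nothing or everything. -/

namespace IsOrliczFunction

/-! ### Growth of Orlicz functions -/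

variable {G : ℝ → ℝ} {C : ℝ}

theorem apply_abs (hG : IsOrliczFunction G C) (x : ℝ) : G |x| = G x := by
  rcases abs_choice x with h | h <;> rw [h]
  exact hG.even x

theorem mono_abs (hG : IsOrliczFunction G C) {x y : ℝ} (h : |x| ≤ |y|) : G x ≤ G y := by
  rw [← hG.apply_abs x, ← hG.apply_abs y]
  exact hG.strictMonoOn.monotoneOn (abs_nonneg x) (abs_nonneg y) h

theorem strictMono_abs (hG : IsOrliczFunction G C) {x y : ℝ} (h : |x| < |y|) : G x < G y := by
  rw [← hG.apply_abs x, ← hG.apply_abs y]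
  exact hG.strictMonoOn (abs_nonneg x) (abs_nonneg y) h

theorem nonneg (hG : IsOrliczFunction G C) (x : ℝ) : 0 ≤ G x := by
  rw [← hG.map_zero]
  exact hG.mono_abs (by simp)

theorem pos (hG : IsOrliczFunction G C) {x : ℝ} (hx : x ≠ 0) : 0 < G x := by
  rw [← hG.map_zero]
  exact hG.strictMono_abs (by simpa using hx)

theorem ne_zero_of_pos (hG : IsOrliczFunction G C) {x : ℝ} (hx : 0 < G x) : x ≠ 0 := by
  rintro rfl
  exact hx.ne' hG.map_zero

/-- An even function that is convex and increasing on the half-line is convex on the whole line, by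
the triangle inequality for `|·|`. -/
theorem convex (hG : IsOrliczFunction G C) (x y : ℝ) {a b : ℝ} (ha : 0 ≤ a) (hb : 0 ≤ b)
    (hab : a + b = 1) : G (a * x + b * y) ≤ a * G x + b * G y := by
  have h := hG.convexOn.2 (abs_nonneg x : |x| ∈ Set.Ici 0) (abs_nonneg y : |y| ∈ Set.Ici 0) ha hb hab
  simp only [smul_eq_mul, hG.apply_abs] at h
  refine le_trans (hG.mono_abs ?_) h
  rw [abs_of_nonneg (a := a * |x| + b * |y|) (by positivity)]
  refine (abs_add_le _ _).trans ?_
  rw [abs_mul, abs_mul, abs_of_nonneg ha, abs_of_nonneg hb]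

theorem mul_le (hG : IsOrliczFunction G C) (x : ℝ) {t : ℝ} (h0 : 0 ≤ t) (h1 : t ≤ 1) :
    G (t * x) ≤ t * G x := by
  have := hG.convex x 0 h0 (sub_nonneg.2 h1) (by ring)
  simpa [hG.map_zero] using this

/-- Strict monotonicity and the growth condition give `1 < C s²` for every `s > 1`; a `C < 1` is
refuted by `s = 1/√C`. -/
theorem one_le_const (hG : IsOrliczFunction G C) : 1 ≤ C := by
  have key : ∀ s : ℝ, 1 < s → 1 < C * s ^ 2 := fun s hs => by
    have h := hG.growth 1 s one_pos hs
    have h1 : 0 < G 1 := hG.pos one_ne_zero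
    have h2 : G 1 < G s := hG.strictMono_abs (by rw [abs_one, abs_of_pos] <;> linarith)
    rw [div_one] at h
    exact lt_of_lt_of_le ((one_lt_div h1).2 h2) h
  by_contra hC
  rw [not_le] at hC
  have hC0 : 0 < C := by linarith [key 2 (by norm_num)]
  have hs : 0 < √C := Real.sqrt_pos.2 hC0
  have h := key (√C)⁻¹ ((one_lt_inv₀ hs).2 (by rw [Real.sqrt_lt' one_pos]; linarith))
  rw [inv_pow, Real.sq_sqrt hC0.le, mul_inv_cancel₀ hC0.ne'] at h
  exact lt_irrefl _ h

theorem mul_le_sq (hG : IsOrliczFunction G C) (x : ℝ) {t : ℝ} (h1 : 1 ≤ t) :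
    G (t * x) ≤ C * t ^ 2 * G x := by
  have hC := hG.one_le_const
  rcases eq_or_ne x 0 with rfl | hx
  · simp [hG.map_zero]
  rcases h1.eq_or_lt with rfl | h1
  · have := hG.nonneg x
    rw [one_mul]; nlinarith
  have hx' : 0 < |x| := abs_pos.2 hx
  have h := hG.growth |x| (t * |x|) hx' (by nlinarith)
  rw [mul_div_cancel_right₀ _ hx'.ne', div_le_iff₀ (by rw [hG.apply_abs]; exact hG.pos hx),
    hG.apply_abs] at h
  rwa [← hG.apply_abs, abs_mul, abs_of_pos (by linarith : (0:ℝ) < t)]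

/-- Division-free form of quadratic growth: a row with a smaller inner product still contributes to
the modular at least in proportion to its square. This is what transfers the modular to Gram
matrices. -/
theorem div_le_sq (hG : IsOrliczFunction G C) {x y : ℝ} (hy : y ≠ 0) (h : |x| ≤ |y|) :
    G y * x ^ 2 ≤ C * y ^ 2 * G x := by
  rcases eq_or_ne x 0 with rfl | hx
  · simp [hG.map_zero]
  have hx' : 0 < |x| := abs_pos.2 hx
  have := hG.mul_le_sq |x| (t := |y| / |x|) ((one_le_div hx').2 h)
  rw [div_mul_cancel₀ _ hx'.ne', hG.apply_abs, hG.apply_abs, div_pow, sq_abs, sq_abs] at this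
  have hx2 : 0 < x ^ 2 := by positivity
  calc G y * x ^ 2 ≤ (C * (y ^ 2 / x ^ 2) * G x) * x ^ 2 := by gcongr
    _ = C * y ^ 2 * G x := by field_simp

theorem continuousOn_Ioi (hG : IsOrliczFunction G C) : ContinuousOn G (Set.Ioi 0) :=
  (hG.convexOn.subset Set.Ioi_subset_Ici_self (convex_Ioi 0)).continuousOn isOpen_Ioi

/-- Convexity and `G 0 = 0` make `G x / x` nondecreasing. -/
theorem one_le_ratio (hG : IsOrliczFunction G C) {a b : ℝ} (ha : 0 < a) (hab : a ≤ b) :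
    1 ≤ (G b * a) / (G a * b) := by
  have hb := ha.trans_le hab
  rw [one_le_div (mul_pos (hG.pos ha.ne') hb)]
  have := hG.mul_le b (t := a / b) (by positivity) ((div_le_one hb).2 hab)
  rw [div_mul_cancel₀ _ hb.ne', div_mul_eq_mul_div, le_div_iff₀ hb] at this
  linarith

/-! ### Existence and uniqueness of the norm value -/

variable {ι : Type*} [Fintype ι]

theorem continuousOn_modular (hG : IsOrliczFunction G C) (w v : ι → ℝ) :
    ContinuousOn (fun α : ℝ => ∑ i, w i * G (|v i| / α)) (Set.Ioi 0) := by
  refine continuousOn_finsetSum _ fun i _ => ContinuousOn.mul continuousOn_const ?_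
  by_cases hv : v i = 0
  · simp [hv, continuousOn_const]
  · refine hG.continuousOn_Ioi.comp (ContinuousOn.div continuousOn_const continuousOn_id
      fun x hx => (Set.mem_Ioi.1 hx).ne') fun x hx => div_pos (abs_pos.2 hv) hx

/-- The modular decays at least like `1/α`. This strict decay gives both the bracketing and the
uniqueness of the level `1`. -/
theorem modular_scale (hG : IsOrliczFunction G C) {w : ι → ℝ} (hw : ∀ i, 0 < w i) (v : ι → ℝ)
    {a b : ℝ} (ha : 0 < a) (hab : a ≤ b) :
    ∑ i, w i * G (|v i| / b) ≤ a / b * ∑ i, w i * G (|v i| / a) := by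
  have hb := ha.trans_le hab
  rw [Finset.mul_sum]
  refine Finset.sum_le_sum fun i _ => ?_
  have := hG.mul_le (|v i| / a) (t := a / b) (by positivity) ((div_le_one hb).2 hab)
  rw [show a / b * (|v i| / a) = |v i| / b by field_simp] at this
  calc w i * G (|v i| / b) ≤ w i * (a / b * G (|v i| / a)) := by
        have := hw i; gcongr
    _ = _ := by ring

theorem exists_weightedOrliczNorm (hG : IsOrliczFunction G C) {w : ι → ℝ} (hw : ∀ i, 0 < w i)
    {v : ι → ℝ} (hv : v ≠ 0) :
    0 < weightedOrliczNorm G w v ∧ ∑ i, w i * G (|v i| / weightedOrliczNorm G w v) = 1 := by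
  set F : ℝ → ℝ := fun α => ∑ i, w i * G (|v i| / α) with hF
  obtain ⟨i₀, hi₀⟩ := Function.ne_iff.1 hv
  have hF1 : 0 < F 1 := by
    refine Finset.sum_pos' (fun i _ => mul_nonneg (hw i).le (hG.nonneg _))
      ⟨i₀, Finset.mem_univ _, mul_pos (hw i₀) (hG.pos ?_)⟩
    simpa using hi₀
  -- By the scaling estimate the level `1` is crossed between `1` and `F 1`, so the intermediate
  -- value theorem applies there.
  have hsub : Set.Icc (min 1 (F 1)) (max 1 (F 1)) ⊆ Set.Ioi 0 := fun x hx =>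
    lt_of_lt_of_le (lt_min one_pos hF1) hx.1
  have hle : min 1 (F 1) ≤ max 1 (F 1) := (min_le_left _ _).trans (le_max_left _ _)
  have h1 : F (max 1 (F 1)) ≤ 1 := by
    have := hG.modular_scale hw v one_pos (le_max_left 1 (F 1))
    refine this.trans ?_
    rw [one_div, inv_mul_le_iff₀ (by positivity), mul_one]
    exact le_max_right _ _
  have h2 : 1 ≤ F (min 1 (F 1)) := by
    have hm : 0 < min 1 (F 1) := lt_min one_pos hF1
    have := hG.modular_scale hw v hm (min_le_left 1 (F 1))
    rw [div_one] at this
    have h3 : F 1 ≤ min 1 (F 1) * F (min 1 (F 1)) := this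
    rcases le_total 1 (F 1) with h | h
    · rw [min_eq_left h] at h3 ⊢; linarith
    · rw [min_eq_right h] at h3 ⊢
      by_contra hc
      nlinarith
  obtain ⟨α, hα, hα1⟩ := intermediate_value_Icc' hle ((hG.continuousOn_modular w v).mono hsub)
    ⟨h1, h2⟩
  have hα0 : 0 < α := hsub hα
  have hset : {α : ℝ | 0 < α ∧ ∑ i, w i * G (|v i| / α) = 1} = {α} := by
    ext β
    refine ⟨fun ⟨hβ0, hβ⟩ => ?_, fun h => by rw [Set.mem_singleton_iff.1 h]; exact ⟨hα0, hα1⟩⟩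
    rw [Set.mem_singleton_iff]
    rcases lt_trichotomy β α with h | h | h
    · have := hG.modular_scale hw v hβ0 h.le
      rw [hβ, show ∑ i, w i * G (|v i| / α) = 1 from hα1, mul_one, one_le_div hα0] at this
      linarith
    · exact h
    · have := hG.modular_scale hw v hα0 h.le
      rw [hβ, show ∑ i, w i * G (|v i| / α) = 1 from hα1, mul_one, one_le_div hβ0] at this
      linarith
  have : weightedOrliczNorm G w v = α := by
    unfold weightedOrliczNorm
    rw [hset, csInf_singleton]
  rw [this]
  exact ⟨hα0, hα1⟩

theorem weightedOrliczNorm_zero (hG : IsOrliczFunction G C) (w : ι → ℝ) :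
    weightedOrliczNorm G w 0 = 0 := by
  simp [weightedOrliczNorm, hG.map_zero]

theorem weightedOrliczNorm_nonneg (hG : IsOrliczFunction G C) {w : ι → ℝ} (hw : ∀ i, 0 < w i)
    (v : ι → ℝ) : 0 ≤ weightedOrliczNorm G w v := by
  rcases eq_or_ne v 0 with rfl | hv
  · rw [hG.weightedOrliczNorm_zero]
  · exact (hG.exists_weightedOrliczNorm hw hv).1.le

/-- Replaces the infimum by a modular inequality; from here on norms are handled through their
sublevel sets. -/
theorem weightedOrliczNorm_le_iff (hG : IsOrliczFunction G C) {w : ι → ℝ} (hw : ∀ i, 0 < w i)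
    (v : ι → ℝ) {c : ℝ} (hc : 0 < c) :
    weightedOrliczNorm G w v ≤ c ↔ ∑ i, w i * G (v i / c) ≤ 1 := by
  have habs : ∀ i, G (v i / c) = G (|v i| / c) := fun i => by
    rw [← hG.apply_abs (v i / c), abs_div, abs_of_pos hc]
  simp only [habs]
  rcases eq_or_ne v 0 with rfl | hv
  · simp [hG.weightedOrliczNorm_zero, hG.map_zero, hc.le]
  obtain ⟨h0, h1⟩ := hG.exists_weightedOrliczNorm hw hv
  set α := weightedOrliczNorm G w v
  constructor
  · intro h
    have := hG.modular_scale hw v h0 h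
    rw [h1, mul_one] at this
    exact this.trans ((div_le_one hc).2 h)
  · intro h
    by_contra hlt
    rw [not_le] at hlt
    have := hG.modular_scale hw v hc hlt.le
    rw [h1] at this
    have h3 : c / α < 1 := (div_lt_one h0).2 hlt
    have h4 : 0 < c / α := by positivity
    nlinarith

end IsOrliczFunction

theorem orliczNorm_eq_weighted {ι : Type*} [Fintype ι] (G : ℝ → ℝ) (v : ι → ℝ) :
    orliczNorm G v = weightedOrliczNorm G (fun _ => 1) v := by
  simp [orliczNorm, weightedOrliczNorm]

/-- The inner product of an integer row with a coefficient vector. -/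
noncomputable def rowDot {d : ℕ} (a : Fin d → ℤ) (x : Fin d → ℝ) : ℝ := ∑ k, (a k : ℝ) * x k

theorem rowDot_smul {d : ℕ} (a : Fin d → ℤ) (c : ℝ) (x : Fin d → ℝ) :
    rowDot a (c • x) = c * rowDot a x := by
  simp only [rowDot, Pi.smul_apply, smul_eq_mul, Finset.mul_sum]
  exact Finset.sum_congr rfl fun _ _ => by ring

theorem rowDot_add {d : ℕ} (a : Fin d → ℤ) (x y : Fin d → ℝ) :
    rowDot a (x + y) = rowDot a x + rowDot a y := by
  simp [rowDot, mul_add, Finset.sum_add_distrib]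

theorem rowDot_neg {d : ℕ} (a : Fin d → ℤ) (x : Fin d → ℝ) : rowDot a (-x) = -rowDot a x := by
  simp [rowDot]

theorem rowDot_zero {d : ℕ} (a : Fin d → ℤ) : rowDot a 0 = 0 := by
  simp [rowDot]

/-- The modular `∑ G ⟨r j, x⟩` of the rows `r i, …, r (j - 1)`. -/
noncomputable def blockModular {d : ℕ} (G : ℝ → ℝ) (r : ℕ → Fin d → ℤ) (i j : ℕ)
    (x : Fin d → ℝ) : ℝ :=
  ∑ t ∈ Finset.Ico i j, G (rowDot (r t) x)

/-- The weighted modular of a set of sampled rows. -/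
noncomputable def sampleModular {d : ℕ} (G : ℝ → ℝ) (S : Memory d) (x : Fin d → ℝ) : ℝ :=
  ∑ s ∈ S, s.weight * G (rowDot s.row x)

/-- The sampled rows that arrived at time `i` or later. -/
def Memory.since {d : ℕ} (S : Memory d) (i : ℕ) : Memory d := S.filter fun s => i ≤ s.time

theorem Memory.mem_since {d : ℕ} {S : Memory d} {i : ℕ} {s : SampledRow d} :
    s ∈ S.since i ↔ s ∈ S ∧ i ≤ s.time := Finset.mem_filter

/-! ### Modulars, seminorms and comparison on a net -/

section Norms

variable {G : ℝ → ℝ} {C : ℝ} {d : ℕ}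

theorem blockModular_convex (hG : IsOrliczFunction G C) (r : ℕ → Fin d → ℤ) (i j : ℕ)
    (x y : Fin d → ℝ) {a b : ℝ} (ha : 0 ≤ a) (hb : 0 ≤ b) (hab : a + b = 1) :
    blockModular G r i j (a • x + b • y) ≤
      a * blockModular G r i j x + b * blockModular G r i j y := by
  simp only [blockModular, Finset.mul_sum, ← Finset.sum_add_distrib, rowDot_add, rowDot_smul]
  exact Finset.sum_le_sum fun _ _ => hG.convex _ _ ha hb hab

theorem sampleModular_convex (hG : IsOrliczFunction G C) {S : Memory d}
    (hS : ∀ s ∈ S, 0 < s.weight) (x y : Fin d → ℝ) {a b : ℝ} (ha : 0 ≤ a) (hb : 0 ≤ b)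
    (hab : a + b = 1) :
    sampleModular G S (a • x + b • y) ≤ a * sampleModular G S x + b * sampleModular G S y := by
  simp only [sampleModular, Finset.mul_sum, ← Finset.sum_add_distrib, rowDot_add, rowDot_smul]
  refine Finset.sum_le_sum fun s hs => ?_
  have := mul_le_mul_of_nonneg_left
    (hG.convex (rowDot s.row x) (rowDot s.row y) ha hb hab) (hS s hs).le
  linarith

theorem sampleNorm_le_iff (hG : IsOrliczFunction G C) {S : Memory d}
    (hS : ∀ s ∈ S, 0 < s.weight) (x : Fin d → ℝ) {c : ℝ} (hc : 0 < c) :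
    sampleNorm G S x ≤ c ↔ sampleModular G S (c⁻¹ • x) ≤ 1 := by
  unfold sampleNorm sampleModular
  rw [hG.weightedOrliczNorm_le_iff (fun s : S => hS s.1 s.2) _ hc,
    ← Finset.sum_coe_sort S fun s => s.weight * G (rowDot s.row (c⁻¹ • x))]
  simp only [rowDot_smul]
  simp only [div_eq_inv_mul, rowDot]

theorem sampleNorm_nonneg (hG : IsOrliczFunction G C) {S : Memory d}
    (hS : ∀ s ∈ S, 0 < s.weight) (x : Fin d → ℝ) : 0 ≤ sampleNorm G S x :=
  hG.weightedOrliczNorm_nonneg (fun s : S => hS s.1 s.2) _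

theorem rowBlock_mulVec (r : ℕ → Fin d → ℤ) (i j : ℕ) (x : Fin d → ℝ) (t : Finset.Ico i j) :
    (rowBlock r i j *ᵥ x) t = rowDot (r t) x := rfl

theorem blockNorm_le_iff (hG : IsOrliczFunction G C) (r : ℕ → Fin d → ℤ) (i j : ℕ)
    (x : Fin d → ℝ) {c : ℝ} (hc : 0 < c) :
    orliczNorm G (rowBlock r i j *ᵥ x) ≤ c ↔ blockModular G r i j (c⁻¹ • x) ≤ 1 := by
  rw [orliczNorm_eq_weighted, hG.weightedOrliczNorm_le_iff (fun _ => one_pos) _ hc]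
  unfold blockModular
  rw [← Finset.sum_coe_sort (Finset.Ico i j) fun t => G (rowDot (r t) (c⁻¹ • x))]
  simp only [rowDot_smul, div_eq_inv_mul, rowBlock_mulVec, one_mul]

theorem blockNorm_nonneg (hG : IsOrliczFunction G C) (r : ℕ → Fin d → ℤ) (i j : ℕ)
    (x : Fin d → ℝ) : 0 ≤ orliczNorm G (rowBlock r i j *ᵥ x) := by
  rw [orliczNorm_eq_weighted]
  exact hG.weightedOrliczNorm_nonneg (fun _ => one_pos) _

/-- A nonnegative function whose sublevel sets are the dilates of `{ρ ≤ 1}` for a convex even `ρ`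
is a seminorm. -/
theorem exists_seminorm_of_modular {V : Type*} [AddCommGroup V] [Module ℝ V] (ρ N : V → ℝ)
    (hconv : ∀ (x y : V) (a b : ℝ), 0 ≤ a → 0 ≤ b → a + b = 1 →
      ρ (a • x + b • y) ≤ a * ρ x + b * ρ y)
    (heven : ∀ x, ρ (-x) = ρ x) (h0 : ρ 0 ≤ 1) (hN0 : ∀ x, 0 ≤ N x)
    (hN : ∀ x, ∀ c : ℝ, 0 < c → (N x ≤ c ↔ ρ (c⁻¹ • x) ≤ 1)) :
    ∃ p : Seminorm ℝ V, ∀ x, p x = N x := by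
  have hzero : N 0 = 0 := by
    refine le_antisymm (le_of_forall_pos_le_add fun c hc => ?_) (hN0 0)
    rw [zero_add, hN 0 c hc, smul_zero]
    exact h0
  have hadd : ∀ x y, N (x + y) ≤ N x + N y := fun x y => by
    refine le_of_forall_pos_le_add fun e he => ?_
    have ha : 0 < N x + e / 2 := by linarith [hN0 x]
    have hb : 0 < N y + e / 2 := by linarith [hN0 y]
    set a := N x + e / 2
    set b := N y + e / 2
    have h1 := (hN x a ha).1 (by simp only [a]; linarith)
    have h2 := (hN y b hb).1 (by simp only [b]; linarith)
    rw [show N x + N y + e = a + b by simp only [a, b]; ring, hN _ _ (by positivity)]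
    -- The vector `(x + y) / (a + b)` is the convex combination of `x / a` and `y / b` with weights
    -- `a / (a + b)` and `b / (a + b)`.
    have h3 := hconv (a⁻¹ • x) (b⁻¹ • y) (a / (a + b)) (b / (a + b)) (by positivity)
      (by positivity) (by field_simp)
    rw [smul_smul, smul_smul, show a / (a + b) * a⁻¹ = (a + b)⁻¹ by field_simp,
      show b / (a + b) * b⁻¹ = (a + b)⁻¹ by field_simp, ← smul_add] at h3
    refine h3.trans ?_
    have h4 : a / (a + b) + b / (a + b) = 1 := by field_simp
    have h5 : 0 ≤ a / (a + b) := by positivity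
    have h6 : 0 ≤ b / (a + b) := by positivity
    nlinarith
  have hle : ∀ (c : ℝ) (x : V), ∀ e : ℝ, 0 < e → c ≠ 0 → (N (c • x) ≤ e ↔ |c| * N x ≤ e) := by
    intro c x e he hc
    have hc' : 0 < |c| := abs_pos.2 hc
    rw [hN _ _ he, mul_comm, ← le_div_iff₀ hc', hN _ _ (by positivity), smul_smul]
    rcases abs_choice c with h | h
    · rw [h, inv_div, div_eq_inv_mul]
    · rw [h, inv_div, ← heven, ← neg_smul]
      rw [show -(e⁻¹ * c) = -c / e by field_simp]
  refine ⟨Seminorm.of N hadd fun c x => ?_, fun x => rfl⟩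
  rcases eq_or_ne c 0 with rfl | hc
  · simp [hzero]
  rw [Real.norm_eq_abs]
  have hcx : 0 ≤ |c| * N x := mul_nonneg (abs_nonneg _) (hN0 x)
  refine le_antisymm (le_of_forall_pos_le_add fun e he => ?_)
    (le_of_forall_pos_le_add fun e he => ?_)
  · rw [hle c x _ (by linarith) hc]; linarith
  · rw [← hle c x _ (by linarith [hN0 (c • x)]) hc]; linarith

theorem exists_seminorm_blockNorm (hG : IsOrliczFunction G C) (r : ℕ → Fin d → ℤ) (i j : ℕ) :
    ∃ p : Seminorm ℝ (Fin d → ℝ), ∀ x, p x = orliczNorm G (rowBlock r i j *ᵥ x) :=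
  exists_seminorm_of_modular (blockModular G r i j) _
    (fun x y a b ha hb hab => blockModular_convex hG r i j x y ha hb hab)
    (fun x => by simp [blockModular, rowDot_neg, hG.even])
    (by simp [blockModular, rowDot_zero, hG.map_zero])
    (fun x => blockNorm_nonneg hG r i j x) (fun x c hc => blockNorm_le_iff hG r i j x hc)

theorem exists_seminorm_sampleNorm (hG : IsOrliczFunction G C) {S : Memory d}
    (hS : ∀ s ∈ S, 0 < s.weight) :
    ∃ p : Seminorm ℝ (Fin d → ℝ), ∀ x, p x = sampleNorm G S x :=
  exists_seminorm_of_modular (sampleModular G S) _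
    (fun x y a b ha hb hab => sampleModular_convex hG hS x y ha hb hab)
    (fun x => by simp [sampleModular, rowDot_neg, hG.even])
    (by simp [sampleModular, rowDot_zero, hG.map_zero])
    (fun x => sampleNorm_nonneg hG hS x) (fun x c hc => sampleNorm_le_iff hG hS x hc)

/-- If a seminorm `q` is within `η` of `p` on an `η`-net of the unit sphere of `p`, then it is
comparable with `p` everywhere. -/
theorem seminorm_compare_of_net {V : Type*} [AddCommGroup V] [Module ℝ V] (p q : Seminorm ℝ V)
    (N : Finset V) {η : ℝ} (hη0 : 0 < η) (hη1 : η < 1)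
    (hcover : ∀ z, p z = 1 → ∃ y ∈ N, p (z - y) ≤ η)
    (hq : ∀ y ∈ N, |q y - 1| ≤ η) (hB : ∃ B, ∀ x, q x ≤ B * p x) (x : V) :
    q x ≤ (1 + η) / (1 - η) * p x ∧ (1 - η - η * ((1 + η) / (1 - η))) * p x ≤ q x := by
  obtain ⟨B₀, hB₀⟩ := hB
  by_cases hp : ∀ x, p x = 0
  · have h1 := hB₀ x
    rw [hp x] at h1 ⊢
    have := apply_nonneg q x
    constructor <;> linarith
  push Not at hp
  obtain ⟨x₀, hx₀⟩ := hp
  have hx₀' : 0 < p x₀ := lt_of_le_of_ne (apply_nonneg p _) (Ne.symm hx₀)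
  -- The least constant `B` with `q ≤ B p`. Rounding a unit vector to the net gives `B ≤ 1 + η + B
  -- η`, which can be solved for `B` because `B` is known to be finite.
  set Z : Set ℝ := {B | ∀ x, q x ≤ B * p x} with hZ
  have hbdd : BddBelow Z := ⟨0, fun B hB => by
    have := (apply_nonneg q x₀).trans (hB x₀)
    exact nonneg_of_mul_nonneg_left this hx₀'⟩
  have hne : Z.Nonempty := ⟨B₀, hB₀⟩
  have hmem : ∀ x, q x ≤ sInf Z * p x := fun x => by
    rcases (apply_nonneg p x).eq_or_lt with h | h
    · rw [← h, mul_zero]; have := hB₀ x; rwa [← h, mul_zero] at this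
    · rw [← div_le_iff₀ h]
      exact le_csInf hne fun B hB => (div_le_iff₀ h).2 (hB x)
  have hscale : ∀ z, p z ≠ 0 → p ((p z)⁻¹ • z) = 1 ∧ q ((p z)⁻¹ • z) = (p z)⁻¹ * q z := by
    intro z hz
    have h0 : 0 < (p z)⁻¹ := inv_pos.2 (lt_of_le_of_ne (apply_nonneg p _) (Ne.symm hz))
    simp only [map_smul_eq_mul, Real.norm_eq_abs, abs_of_pos h0]
    exact ⟨inv_mul_cancel₀ hz, trivial⟩
  have hstep : sInf Z ≤ 1 + η + sInf Z * η := by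
    refine csInf_le hbdd fun z => ?_
    by_cases hz : p z = 0
    · have := hmem z; rw [hz, mul_zero] at this ⊢; exact this
    obtain ⟨h1, h2⟩ := hscale z hz
    obtain ⟨y, hy, hzy⟩ := hcover _ h1
    have hpz : 0 < p z := lt_of_le_of_ne (apply_nonneg p _) (Ne.symm hz)
    have h3 : q ((p z)⁻¹ • z) ≤ q y + q ((p z)⁻¹ • z - y) := by
      have := map_add_le_add q y ((p z)⁻¹ • z - y)
      rwa [add_sub_cancel] at this
    have h4 := hmem ((p z)⁻¹ • z - y)
    have h5 := (abs_le.1 (hq y hy)).2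
    have h6 : 0 ≤ sInf Z := by
      have := (apply_nonneg q x₀).trans (hmem x₀)
      exact nonneg_of_mul_nonneg_left this hx₀'
    have h7 := mul_le_mul_of_nonneg_left hzy h6
    rw [h2] at h3
    have h8 : (p z)⁻¹ * q z ≤ 1 + η + sInf Z * η := by linarith
    rwa [inv_mul_le_iff₀ hpz, mul_comm] at h8
  have hB1 : sInf Z ≤ (1 + η) / (1 - η) := by
    rw [le_div_iff₀ (by linarith)]; linarith
  have hup : ∀ x, q x ≤ (1 + η) / (1 - η) * p x := fun x =>
    (hmem x).trans (mul_le_mul_of_nonneg_right hB1 (apply_nonneg p x))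
  refine ⟨hup x, ?_⟩
  by_cases hz : p x = 0
  · rw [hz, mul_zero]; exact apply_nonneg q x
  obtain ⟨h1, h2⟩ := hscale x hz
  obtain ⟨y, hy, hzy⟩ := hcover _ h1
  have hpz : 0 < p x := lt_of_le_of_ne (apply_nonneg p _) (Ne.symm hz)
  -- For the lower bound the rounding is reversed, and the upper bound just obtained controls the
  -- rounding error.
  have h3 : q y ≤ q ((p x)⁻¹ • x) + q ((p x)⁻¹ • x - y) := by
    have := map_sub_le_add q ((p x)⁻¹ • x) ((p x)⁻¹ • x - y)
    rwa [sub_sub_cancel] at this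
  have h4 := hup ((p x)⁻¹ • x - y)
  have h5 := (abs_le.1 (hq y hy)).1
  have h6 : 0 ≤ (1 + η) / (1 - η) := div_nonneg (by linarith) (by linarith)
  have h7 := mul_le_mul_of_nonneg_left hzy h6
  rw [h2] at h3
  have h8 : 1 - η - η * ((1 + η) / (1 - η)) ≤ (p x)⁻¹ * q x := by linarith
  rwa [le_inv_mul_iff₀ hpz, mul_comm] at h8

end Norms

/-! ### Nets of unit spheres -/

open MeasureTheory Metric in
/-- An `η`-separated set in the unit ball of a `k`-dimensional normed space has at most
`(1 + 2 / η) ^ k` points. -/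
theorem card_le_of_separated_of_norm_le_one {E : Type*} [NormedAddCommGroup E] [NormedSpace ℝ E]
    [FiniteDimensional ℝ E] (s : Finset E) {η : ℝ} (hη : 0 < η) (hs : ∀ c ∈ s, ‖c‖ ≤ 1)
    (h : ∀ c ∈ s, ∀ e ∈ s, c ≠ e → η ≤ ‖c - e‖) :
    (s.card : ℝ) ≤ (1 + 2 / η) ^ Module.finrank ℝ E := by
  borelize E
  let μ : Measure E := Measure.addHaar
  have hδ : 0 < η / 2 := half_pos hη
  have hρ : 0 < 1 + η / 2 := by positivity
  -- Volume comparison: the balls of radius `η / 2` are disjoint and lie in the ball of radius `1 +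
  -- η / 2`.
  set A := ⋃ c ∈ s, ball (c : E) (η / 2) with hA
  have D : Set.Pairwise (s : Set E) (Function.onFun Disjoint fun c => ball (c : E) (η / 2)) := by
    rintro c hc e he hce
    apply ball_disjoint_ball
    rw [dist_eq_norm, add_halves]
    exact h c hc e he hce
  have A_subset : A ⊆ ball (0 : E) (1 + η / 2) := by
    refine Set.iUnion₂_subset fun x hx => ?_
    apply ball_subset_ball'
    rw [dist_zero_right]
    linarith [hs x hx]
  have I : (s.card : ENNReal) * ENNReal.ofReal ((η / 2) ^ Module.finrank ℝ E) * μ (ball 0 1) ≤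
      ENNReal.ofReal ((1 + η / 2) ^ Module.finrank ℝ E) * μ (ball 0 1) :=
    calc
      _ = μ A := by
        rw [hA, measure_biUnion_finset D fun c _ => measurableSet_ball]
        simp only [μ.addHaar_ball_of_pos _ hδ]
        simp only [Finset.sum_const, nsmul_eq_mul, mul_assoc]
      _ ≤ μ (ball (0 : E) (1 + η / 2)) := measure_mono A_subset
      _ = _ := by simp only [μ.addHaar_ball_of_pos _ hρ]
  have J := (ENNReal.mul_le_mul_iff_left
    (measure_ball_pos μ (0 : E) zero_lt_one).ne' measure_ball_lt_top.ne).1 I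
  have K := ENNReal.toReal_le_of_le_ofReal (pow_nonneg hρ.le _) J
  rw [ENNReal.toReal_mul, ENNReal.toReal_natCast, ENNReal.toReal_ofReal (by positivity),
    ← le_div_iff₀ (by positivity), ← div_pow] at K
  rwa [show (1 + η / 2) / (η / 2) = 1 + 2 / η by field_simp; ring] at K

/-- The same bound for a seminorm. -/
theorem Seminorm.card_le_of_separated {V : Type*} [AddCommGroup V] [Module ℝ V]
    [FiniteDimensional ℝ V] (p : Seminorm ℝ V) (s : Finset V) {η : ℝ} (hη : 0 < η)
    (hs : ∀ c ∈ s, p c ≤ 1) (h : ∀ c ∈ s, ∀ e ∈ s, c ≠ e → η ≤ p (c - e)) :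
    (s.card : ℝ) ≤ (1 + 2 / η) ^ Module.finrank ℝ V := by
  classical
  let _ : SeminormedAddCommGroup V := p.toAddGroupSeminorm.toSeminormedAddCommGroup
  let _ : NormedSpace ℝ V := ⟨fun a b => (map_smul_eq_mul p a b).le⟩
  have hp : ∀ x : V, ‖x‖ = p x := fun x => rfl
  -- Dividing out the kernel of `p` makes it a norm; separated points stay distinct and the
  -- dimension does not increase.
  let f : V →ₗ[ℝ] SeparationQuotient V := (SeparationQuotient.mkCLM ℝ V).toLinearMap
  have hf : ∀ x, ‖f x‖ = p x := fun x => SeparationQuotient.norm_mk x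
  have hsurj : Function.Surjective f := SeparationQuotient.surjective_mk
  have : FiniteDimensional ℝ (SeparationQuotient V) := Module.Finite.of_surjective f hsurj
  have hinj : Set.InjOn f s := fun c hc e he hce => by
    by_contra hne
    have := h c hc e he hne
    rw [← hf, map_sub, hce, sub_self, norm_zero] at this
    linarith
  have key := card_le_of_separated_of_norm_le_one (s.image f) hη
    (fun c hc => by
      obtain ⟨x, hx, rfl⟩ := Finset.mem_image.1 hc
      rw [hf]; exact hs x hx)
    (fun c hc e he hce => by
      obtain ⟨x, hx, rfl⟩ := Finset.mem_image.1 hc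
      obtain ⟨y, hy, rfl⟩ := Finset.mem_image.1 he
      rw [← map_sub, hf]
      exact h x hx y hy fun hxy => hce (by rw [hxy]))
  rw [Finset.card_image_of_injOn hinj] at key
  refine key.trans (pow_le_pow_right₀ ?_ (LinearMap.finrank_le_finrank_of_surjective hsurj))
  have : 0 < 2 / η := by positivity
  linarith

/-- The unit sphere of a seminorm has an `η`-net with at most `(1 + 2 / η) ^ dim` points. -/
theorem Seminorm.exists_net {V : Type*} [AddCommGroup V] [Module ℝ V]
    [FiniteDimensional ℝ V] (p : Seminorm ℝ V) {η : ℝ} (hη : 0 < η) :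
    ∃ N : Finset V, (∀ y ∈ N, p y = 1) ∧ (N.card : ℝ) ≤ (1 + 2 / η) ^ Module.finrank ℝ V ∧
      ∀ z, p z = 1 → ∃ y ∈ N, p (z - y) ≤ η := by
  classical
  -- A separated set of maximal cardinality, which exists by the volume bound, is a net: an
  -- uncovered point could be added to it.
  set P : ℕ → Prop := fun k => ∃ s : Finset V, (∀ y ∈ s, p y = 1) ∧
    (∀ c ∈ s, ∀ e ∈ s, c ≠ e → η ≤ p (c - e)) ∧ s.card = k with hP
  set M := ⌈(1 + 2 / η) ^ Module.finrank ℝ V⌉₊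
  have hbound : ∀ k, P k → (k : ℝ) ≤ (1 + 2 / η) ^ Module.finrank ℝ V := by
    rintro k ⟨s, h1, h2, rfl⟩
    exact p.card_le_of_separated s hη (fun c hc => (h1 c hc).le) h2
  have hP0 : P 0 := ⟨∅, by simp⟩
  obtain ⟨s, h1, h2, h3⟩ := Nat.findGreatest_spec (P := P) (Nat.zero_le M) hP0
  refine ⟨s, h1, hbound _ ⟨s, h1, h2, rfl⟩, fun z hz => ?_⟩
  by_contra hcon
  push Not at hcon
  have hzs : z ∉ s := fun hmem => by
    have := hcon z hmem
    rw [sub_self, map_zero] at this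
    linarith
  have hnew : P (s.card + 1) := by
    refine ⟨insert z s, ?_, ?_, Finset.card_insert_of_notMem hzs⟩
    · intro y hy
      rcases Finset.mem_insert.1 hy with rfl | hy
      exacts [hz, h1 y hy]
    · intro c hc e he hce
      rcases Finset.mem_insert.1 hc with hc | hc <;> rcases Finset.mem_insert.1 he with he | he
      · exact absurd (hc.trans he.symm) hce
      · rw [hc]; exact (hcon e he).le
      · rw [he, map_sub_rev]; exact (hcon c hc).le
      · exact h2 c hc e he hce
  have hle : s.card + 1 ≤ M := by
    have := (hbound _ hnew).trans (Nat.le_ceil _)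
    exact_mod_cast this
  have := Nat.le_findGreatest hle hnew
  omega

/-! ### Singular values and the condition number -/

section SingularValues

open Module

variable {E F : Type*} [NormedAddCommGroup E] [InnerProductSpace ℝ E] [FiniteDimensional ℝ E]
  [NormedAddCommGroup F] [InnerProductSpace ℝ F] [FiniteDimensional ℝ F]

/-- Expand `x` in an orthonormal eigenbasis of `T* T`, whose eigenvalues are the squared singular
values. -/
theorem LinearMap.norm_sq_eq_sum_singularValues (T : E →ₗ[ℝ] F) (x : E) :
    ‖T x‖ ^ 2 = ∑ i : Fin (finrank ℝ E), T.singularValues i ^ 2 *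
      ((T.isSymmetric_adjoint_comp_self.eigenvectorBasis rfl).repr x i) ^ 2 := by
  set b := T.isSymmetric_adjoint_comp_self.eigenvectorBasis rfl
  rw [← real_inner_self_eq_norm_sq, ← LinearMap.adjoint_inner_right,
    ← b.repr.inner_map_map, PiLp.inner_apply]
  refine Finset.sum_congr rfl fun i _ => ?_
  have h := T.isSymmetric_adjoint_comp_self.eigenvectorBasis_apply_self_apply rfl x i
  rw [LinearMap.comp_apply] at h
  simp only [b] at h ⊢
  rw [h, T.sq_singularValues_fin rfl]
  simp only [RCLike.inner_apply, conj_trivial, RCLike.ofReal_real_eq_id, id_eq]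
  ring

theorem LinearMap.norm_le_singularValues_zero (T : E →ₗ[ℝ] F) (x : E) :
    ‖T x‖ ≤ T.singularValues 0 * ‖x‖ := by
  refine le_of_sq_le_sq ?_ (mul_nonneg (T.singularValues_nonneg 0) (norm_nonneg x))
  rw [T.norm_sq_eq_sum_singularValues, mul_pow,
    ← (T.isSymmetric_adjoint_comp_self.eigenvectorBasis rfl).repr.norm_map x,
    EuclideanSpace.real_norm_sq_eq, Finset.mul_sum]
  refine Finset.sum_le_sum fun i _ => mul_le_mul_of_nonneg_right ?_ (sq_nonneg _)
  exact pow_le_pow_left₀ (T.singularValues_nonneg _) (T.singularValues_antitone (Nat.zero_le _)) 2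

/-- Every vector agrees modulo the kernel with one whose norm is controlled by the smallest nonzero
singular value. -/
theorem LinearMap.exists_eq_singularValues_mul_norm_le (T : E →ₗ[ℝ] F) (x : E) :
    ∃ y, T y = T x ∧ T.singularValues (finrank ℝ T.range - 1) * ‖y‖ ≤ ‖T x‖ := by
  set b := T.isSymmetric_adjoint_comp_self.eigenvectorBasis rfl with hb
  set k := finrank ℝ T.range with hk
  -- Deleting the coordinates with vanishing singular value projects `x` orthogonally to the kernel.
  set c : EuclideanSpace ℝ (Fin (finrank ℝ E)) :=
    WithLp.toLp 2 fun i => if (i : ℕ) < k then b.repr x i else 0 with hc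
  set y := b.repr.symm c with hy
  have hry : ∀ i, b.repr y i = if (i : ℕ) < k then b.repr x i else 0 := fun i => by
    rw [hy, LinearIsometryEquiv.apply_symm_apply]
  have hzero : ∀ i : Fin (finrank ℝ E), ¬ (i : ℕ) < k → T.singularValues i = 0 := fun i hi => by
    rw [T.singularValues_eq_zero_iff_le_finrank_range]; exact not_lt.1 hi
  have hT : T y = T x := by
    rw [← sub_eq_zero, ← map_sub, ← norm_eq_zero, ← sq_eq_zero_iff,
      T.norm_sq_eq_sum_singularValues]
    refine Finset.sum_eq_zero fun i _ => ?_
    rw [map_sub, PiLp.sub_apply, ← hb, hry]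
    by_cases hi : (i : ℕ) < k
    · simp [hi]
    · simp [hzero i hi]
  refine ⟨y, hT, ?_⟩
  rw [← hT]
  refine le_of_sq_le_sq ?_ (norm_nonneg _)
  rw [T.norm_sq_eq_sum_singularValues, mul_pow, ← b.repr.norm_map y,
    EuclideanSpace.real_norm_sq_eq, Finset.mul_sum]
  refine Finset.sum_le_sum fun i _ => ?_
  rw [← hb, hry]
  split_ifs with hi
  · refine mul_le_mul_of_nonneg_right ?_ (sq_nonneg _)
    exact pow_le_pow_left₀ (T.singularValues_nonneg _)
      (T.singularValues_antitone (Nat.le_sub_one_of_lt hi)) 2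
  · simp

end SingularValues

theorem toEuclideanLin_rowBlock_apply {d : ℕ} (r : ℕ → Fin d → ℤ) (i j : ℕ)
    (x : EuclideanSpace ℝ (Fin d)) (t : Finset.Ico i j) :
    (Matrix.toEuclideanLin (𝕜 := ℝ) (rowBlock r i j) x) t = rowDot (r t) x := rfl

theorem norm_sq_toEuclideanLin_rowBlock {d : ℕ} (r : ℕ → Fin d → ℤ) (i j : ℕ)
    (x : EuclideanSpace ℝ (Fin d)) :
    ‖Matrix.toEuclideanLin (𝕜 := ℝ) (rowBlock r i j) x‖ ^ 2 =
      ∑ t ∈ Finset.Ico i j, rowDot (r t) x ^ 2 := by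
  rw [EuclideanSpace.real_norm_sq_eq, ← Finset.sum_coe_sort (Finset.Ico i j)]
  rfl

/-- The products of the rows of a well-conditioned integer matrix with `x` are attained by a vector
of controlled Euclidean norm. -/
theorem exists_rowDot_eq_sum_sq_le {d : ℕ} (r : ℕ → Fin d → ℤ) (i j : ℕ) {κ : ℝ} (hκ : 0 < κ)
    (h : conditionNumber (rowBlock r i j) ≤ κ) (x : Fin d → ℝ) :
    ∃ y : Fin d → ℝ, (∀ t ∈ Finset.Ico i j, rowDot (r t) y = rowDot (r t) x) ∧
      ∑ k, y k ^ 2 ≤ κ ^ 2 * ∑ t ∈ Finset.Ico i j, rowDot (r t) x ^ 2 := by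
  by_cases hA : ∀ t ∈ Finset.Ico i j, r t = 0
  · refine ⟨0, fun t ht => by simp [rowDot, hA t ht], ?_⟩
    simp only [Pi.zero_apply, ne_eq, OfNat.ofNat_ne_zero, not_false_eq_true, zero_pow,
      Finset.sum_const_zero]
    positivity
  push Not at hA
  obtain ⟨t₀, ht₀, hr₀⟩ := hA
  obtain ⟨k₀, hk₀⟩ := Function.ne_iff.1 hr₀
  set T := Matrix.toEuclideanLin (𝕜 := ℝ) (rowBlock r i j) with hT
  have hrank : (rowBlock r i j).rank = Module.finrank ℝ T.range := by
    refine (Matrix.rank_eq_finrank_range_toLin _ (PiLp.basisFun 2 ℝ _)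
      (PiLp.basisFun 2 ℝ _)).trans ?_
    rw [← Matrix.toLpLin_eq_toLin]
  -- Integrality enters here: a nonzero entry has absolute value at least `1`. Hence the smallest
  -- nonzero singular value is at least `1/κ`.
  have h1 : 1 ≤ T.singularValues 0 := by
    have hle := T.norm_le_singularValues_zero (EuclideanSpace.single k₀ 1)
    rw [PiLp.norm_single, norm_one, mul_one] at hle
    have hcoord := PiLp.norm_apply_le (T (EuclideanSpace.single k₀ 1)) ⟨t₀, ht₀⟩
    have hval : (T (EuclideanSpace.single k₀ 1)) ⟨t₀, ht₀⟩ = (r t₀ k₀ : ℝ) := by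
      rw [hT, toEuclideanLin_rowBlock_apply]
      simp [rowDot]
    rw [hval, Real.norm_eq_abs] at hcoord
    have : (1 : ℝ) ≤ |(r t₀ k₀ : ℝ)| := by
      exact_mod_cast Int.one_le_abs (by simpa using hk₀)
    linarith
  have hpos : 0 < T.singularValues (Module.finrank ℝ T.range - 1) := by
    rw [T.singularValues_pos_iff_lt_finrank_range]
    have : 0 < Module.finrank ℝ T.range :=
      T.singularValues_pos_iff_lt_finrank_range.1 (by linarith)
    omega
  have h2 : 1 ≤ κ * T.singularValues (Module.finrank ℝ T.range - 1) := by
    unfold conditionNumber at h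
    rw [hrank, ← hT, div_le_iff₀ hpos] at h
    linarith
  obtain ⟨y, hy, hyn⟩ := T.exists_eq_singularValues_mul_norm_le (WithLp.toLp 2 x)
  refine ⟨y, fun t ht => ?_, ?_⟩
  · have := congrArg (fun z => z.ofLp ⟨t, ht⟩) hy
    exact this
  · have h3 : ‖y‖ ≤ κ * ‖T (WithLp.toLp 2 x)‖ := by
      have h4 := mul_le_mul_of_nonneg_left hyn hκ.le
      have h5 := mul_le_mul_of_nonneg_right h2 (norm_nonneg y)
      linarith
    have h6 := pow_le_pow_left₀ (norm_nonneg y) h3 2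
    rw [mul_pow, hT, norm_sq_toEuclideanLin_rowBlock, EuclideanSpace.real_norm_sq_eq] at h6
    exact h6

/-! ### Colouring of conflicts and growth of Gram determinants -/

/-- Greedy colouring: if the conflicts `a i j` of `i` with the later `j` sum up to at most `A`, then
with `m` colours the conflicts inside every colour class can be made at most `A / m`. -/
theorem exists_coloring (J : Finset ℕ) (a : ℕ → ℕ → ℝ) {A : ℝ} {m : ℕ} (hm : 0 < m)
    (ha : ∀ i ∈ J, ∑ j ∈ J with i < j, a i j ≤ A) :
    ∃ f : ℕ → Fin m, ∀ i ∈ J, ∑ j ∈ J with i < j ∧ f j = f i, a i j ≤ A / m := by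
  induction J using Finset.induction_on_min with
  | empty => exact ⟨fun _ => ⟨0, hm⟩, by simp⟩
  | insert i s hi ih =>
    have hfil : ∀ i' ∈ s, ∀ P : ℕ → Prop, ∀ [DecidablePred P],
        ({j ∈ insert i s | i' < j ∧ P j} : Finset ℕ) = {j ∈ s | i' < j ∧ P j} := by
      intro i' hi' P _
      rw [Finset.filter_insert, if_neg]
      intro h
      exact absurd h.1 (not_lt.2 (hi i' hi').le)
    have hfil' : ∀ i' ∈ s, ({j ∈ insert i s | i' < j} : Finset ℕ) = {j ∈ s | i' < j} := by
      intro i' hi'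
      rw [Finset.filter_insert, if_neg (not_lt.2 (hi i' hi').le)]
    obtain ⟨f, hf⟩ := ih fun i' hi' => by
      have := ha i' (Finset.mem_insert_of_mem hi')
      rwa [hfil' i' hi'] at this
    have hself : ({j ∈ insert i s | i < j} : Finset ℕ) = s := by
      rw [Finset.filter_insert, if_neg (lt_irrefl i)]
      exact Finset.filter_true_of_mem hi
    have hA := ha i (Finset.mem_insert_self i s)
    rw [hself] at hA
    -- Indices are inserted from the largest down. Conflicts point only to later indices, so the new
    -- one does not disturb the others, and some colour carries at most the average of its
    -- conflicts.
    obtain ⟨c, -, hc⟩ : ∃ c ∈ (Finset.univ : Finset (Fin m)),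
        ∑ j ∈ s with f j = c, a i j ≤ A / m := by
      have : Nonempty (Fin m) := ⟨⟨0, hm⟩⟩
      refine Finset.exists_le_of_sum_le Finset.univ_nonempty ?_
      rw [Finset.sum_fiberwise, Finset.sum_const, Finset.card_univ, Fintype.card_fin, nsmul_eq_mul,
        mul_div_cancel₀ _ (by positivity)]
      exact hA
    have hne : ∀ j ∈ s, j ≠ i := fun j hj => (hi j hj).ne'
    refine ⟨Function.update f i c, fun i' hi' => ?_⟩
    rcases Finset.mem_insert.1 hi' with rfl | hi'
    · rw [Function.update_self]
      convert hc using 2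
      ext j
      simp only [Finset.mem_filter, Finset.mem_insert]
      constructor
      · rintro ⟨h1 | h1, h2, h3⟩
        · omega
        · rw [Function.update_of_ne (hne j h1)] at h3
          exact ⟨h1, h3⟩
      · rintro ⟨h1, h2⟩
        exact ⟨Or.inr h1, hi j h1, by rwa [Function.update_of_ne (hne j h1)]⟩
    · rw [hfil i' hi']
      convert hf i' hi' using 2
      ext j
      simp only [Finset.mem_filter]
      refine and_congr_right fun hj => ?_
      rw [Function.update_of_ne (hne j hj), Function.update_of_ne (hne i' hi')]

section Determinant

variable {d : ℕ}

/-- The regularised Gram matrix `lam • 1 + ∑ a j (a j)ᵀ`. -/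
noncomputable def ridgeGram (lam : ℝ) (a : ℕ → Fin d → ℝ) (J : Finset ℕ) :
    Matrix (Fin d) (Fin d) ℝ :=
  lam • (1 : Matrix (Fin d) (Fin d) ℝ) + ∑ j ∈ J, vecMulVec (a j) (a j)

theorem dotProduct_vecMulVec_mulVec (a x : Fin d → ℝ) :
    x ⬝ᵥ (vecMulVec a a *ᵥ x) = (a ⬝ᵥ x) ^ 2 := by
  rw [vecMulVec_mulVec, dotProduct_smul, dotProduct_comm x a, sq]
  rfl

theorem dotProduct_ridgeGram_mulVec (lam : ℝ) (a : ℕ → Fin d → ℝ) (J : Finset ℕ)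
    (x : Fin d → ℝ) :
    x ⬝ᵥ (ridgeGram lam a J *ᵥ x) = lam * ∑ k, x k ^ 2 + ∑ j ∈ J, (a j ⬝ᵥ x) ^ 2 := by
  rw [ridgeGram, add_mulVec, dotProduct_add, smul_mulVec, one_mulVec, dotProduct_smul,
    sum_mulVec, dotProduct_sum]
  simp only [dotProduct_vecMulVec_mulVec, smul_eq_mul]
  simp [dotProduct, sq]

theorem ridgeGram_transpose (lam : ℝ) (a : ℕ → Fin d → ℝ) (J : Finset ℕ) :
    (ridgeGram lam a J)ᵀ = ridgeGram lam a J := by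
  simp [ridgeGram, transpose_add, transpose_sum, transpose_vecMulVec]

theorem ridgeGram_posDef {lam : ℝ} (hlam : 0 < lam) (a : ℕ → Fin d → ℝ) (J : Finset ℕ) :
    (ridgeGram lam a J).PosDef := by
  refine Matrix.PosDef.of_dotProduct_mulVec_pos ?_ fun x hx => ?_
  · rw [Matrix.IsHermitian, conjTranspose_eq_transpose_of_trivial, ridgeGram_transpose]
  · rw [star_trivial, dotProduct_ridgeGram_mulVec]
    obtain ⟨k, hk⟩ := Function.ne_iff.1 hx
    have h1 : 0 < ∑ k, x k ^ 2 :=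
      Finset.sum_pos' (fun _ _ => sq_nonneg _) ⟨k, Finset.mem_univ k, by
        have : x k ≠ 0 := hk
        positivity⟩
    have h2 : 0 ≤ ∑ j ∈ J, (a j ⬝ᵥ x) ^ 2 := Finset.sum_nonneg fun _ _ => sq_nonneg _
    positivity

/-- If every row has a large component relative to the later ones, the determinant of the
regularised Gram matrix grows geometrically with the number of rows. -/
theorem pow_card_le_det_ridgeGram {lam Γ : ℝ} (hlam : 0 < lam) (hΓ : 0 < Γ) (a : ℕ → Fin d → ℝ)
    (J : Finset ℕ)
    (h : ∀ i ∈ J, ∃ x : Fin d → ℝ, a i ⬝ᵥ x ≠ 0 ∧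
      ∑ j ∈ J with i < j, (a j ⬝ᵥ x) ^ 2 + lam * ∑ k, x k ^ 2 ≤ Γ * (a i ⬝ᵥ x) ^ 2) :
    lam ^ d * (1 + 1 / Γ) ^ J.card ≤ (ridgeGram lam a J).det := by
  induction J using Finset.induction_on_min with
  | empty => simp [ridgeGram]
  | insert i s hi ih =>
    have his : i ∉ s := fun hmem => lt_irrefl _ (hi i hmem)
    have ih' := ih fun i' hi' => by
      obtain ⟨x, hx⟩ := h i' (Finset.mem_insert_of_mem hi')
      rw [Finset.filter_insert, if_neg (not_lt.2 (hi i' hi').le)] at hx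
      exact ⟨x, hx⟩
    obtain ⟨x, hx0, hx⟩ := h i (Finset.mem_insert_self i s)
    rw [Finset.filter_insert, if_neg (lt_irrefl i), Finset.filter_true_of_mem hi] at hx
    set B := ridgeGram lam a s with hB
    have hBpd : B.PosDef := ridgeGram_posDef hlam a s
    have hdet : 0 < B.det := hBpd.det_pos
    have hunit : IsUnit B.det := hdet.ne'.isUnit
    have hins : ridgeGram lam a (insert i s) =
        B + replicateCol Unit (a i) * replicateRow Unit (a i) := by
      rw [hB, ridgeGram, ridgeGram, Finset.sum_insert his, add_comm (vecMulVec (a i) (a i)),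
        ← add_assoc, vecMulVec_eq Unit]
    rw [hins, det_add_replicateCol_mul_replicateRow hunit, Finset.card_insert_of_notMem his]
    set q := a i ⬝ᵥ (B⁻¹ *ᵥ a i) with hq
    have hqdet : (1 + replicateRow Unit (a i) * B⁻¹ * replicateCol Unit (a i)).det = 1 + q := by
      rw [det_unique, Matrix.add_apply, Matrix.one_apply_eq, Matrix.mul_assoc,
        ← replicateCol_mulVec, replicateRow_mul_replicateCol_apply]
    -- With `y = B⁻¹ a`, `m = ⟨a, x⟩` and `q = ⟨a, y⟩`, the hypothesis says `⟨x, B x⟩ ≤ Γ m²`.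
    -- Nonnegativity of the form of `B` at `x - Γ m y` then yields `Γ q ≥ 1`, so by the matrix
    -- determinant lemma the new row gains a factor `1 + q ≥ 1 + 1/Γ`.
    have hΓq : 1 ≤ Γ * q := by
      set y := B⁻¹ *ᵥ a i with hy
      have hBy : B *ᵥ y = a i := by
        rw [hy, mulVec_mulVec, mul_nonsing_inv _ hunit, one_mulVec]
      set m := a i ⬝ᵥ x with hm
      have hX : x ⬝ᵥ (B *ᵥ x) ≤ Γ * m ^ 2 := by
        rw [hB, dotProduct_ridgeGram_mulVec]; linarith
      have h0 : 0 ≤ (x - (Γ * m) • y) ⬝ᵥ (B *ᵥ (x - (Γ * m) • y)) := by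
        have := hBpd.posSemidef.dotProduct_mulVec_nonneg (x - (Γ * m) • y)
        rwa [star_trivial] at this
      have hyx : y ⬝ᵥ (B *ᵥ x) = m := by
        rw [dotProduct_mulVec, ← mulVec_transpose, hB, ridgeGram_transpose, ← hB, hBy]
      rw [mulVec_sub, mulVec_smul, hBy, dotProduct_sub, sub_dotProduct, sub_dotProduct,
        smul_dotProduct, smul_dotProduct, dotProduct_smul, dotProduct_smul, hyx,
        dotProduct_comm x (a i), dotProduct_comm y (a i)] at h0
      simp only [smul_eq_mul, ← hm] at h0
      have hm2 : 0 < Γ * m ^ 2 := by positivity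
      have h1 : 0 ≤ Γ * m ^ 2 * (Γ * q - 1) := by
        have : a i ⬝ᵥ y = q := rfl
        rw [this] at h0
        nlinarith
      have := nonneg_of_mul_nonneg_right h1 hm2
      linarith
    rw [hqdet, pow_succ, ← mul_assoc]
    refine mul_le_mul ih' ?_ (by positivity) hdet.le
    have : 1 / Γ ≤ q := by rw [div_le_iff₀ hΓ]; linarith
    linarith

/-- The Leibniz expansion with an entrywise bound; crude, but only the logarithm of the determinant
matters. -/
theorem det_ridgeGram_le {lam M : ℝ} (hlam : 0 < lam) (a : ℕ → Fin d → ℝ)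
    (J : Finset ℕ) (ha : ∀ j ∈ J, ∀ k, |a j k| ≤ M) :
    (ridgeGram lam a J).det ≤ (d.factorial : ℝ) * (lam + J.card * M ^ 2) ^ d := by
  have hentry : ∀ k l, AbsoluteValue.abs (ridgeGram lam a J k l) ≤ lam + J.card * M ^ 2 := by
    intro k l
    rw [AbsoluteValue.abs_apply, ridgeGram, Matrix.add_apply, Matrix.sum_apply]
    refine (abs_add_le _ _).trans (add_le_add ?_ ?_)
    · rw [Matrix.smul_apply, Matrix.one_apply]
      split_ifs
      · simp [abs_of_pos hlam]
      · simp [hlam.le]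
    · refine (Finset.abs_sum_le_sum_abs _ _).trans ?_
      rw [← nsmul_eq_mul]
      refine Finset.sum_le_card_nsmul _ _ _ fun j hj => ?_
      rw [vecMulVec_apply, abs_mul, sq]
      exact mul_le_mul (ha j hj k) (ha j hj l) (abs_nonneg _) ((abs_nonneg _).trans (ha j hj k))
  have := Matrix.det_le hentry
  rw [Fintype.card_fin, nsmul_eq_mul, AbsoluteValue.abs_apply] at this
  exact (le_abs_self _).trans this

end Determinant

/-! ### Total sensitivity of the rows among their successors -/

/-- Dyadic summation of a family whose super-level sets satisfy a weak `ℓ¹` bound. -/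
theorem sum_le_of_card_superlevel_le (J : Finset ℕ) (s : ℕ → ℝ) {B : ℝ} (L : ℕ)
    (h1 : ∀ i ∈ J, s i ≤ 1)
    (hB : ∀ k < L, (({i ∈ J | (1 / 2) ^ (k + 1) < s i} : Finset ℕ).card : ℝ) * (1 / 2) ^ (k + 1) ≤ B) :
    ∑ i ∈ J, s i ≤ J.card * (1 / 2) ^ L + L * B := by
  -- The truncated layer-cake bound: each halving of the threshold is paid by one indicator.
  have hpt : ∀ i ∈ J, s i ≤ (1 / 2) ^ L +
      ∑ k ∈ Finset.range L, if (1 / 2 : ℝ) ^ (k + 1) < s i then (1 / 2 : ℝ) ^ (k + 1) else 0 := by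
    intro i hi
    clear hB
    induction L with
    | zero => simpa using h1 i hi
    | succ L ih =>
      rw [Finset.sum_range_succ]
      split_ifs with h
      · have : (1 / 2 : ℝ) ^ L = (1 / 2) ^ (L + 1) + (1 / 2) ^ (L + 1) := by ring
        linarith
      · have h3 : 0 ≤ ∑ k ∈ Finset.range L,
            if (1 / 2 : ℝ) ^ (k + 1) < s i then (1 / 2 : ℝ) ^ (k + 1) else 0 :=
          Finset.sum_nonneg fun k _ => by split_ifs <;> positivity
        linarith [not_lt.1 h]
  refine (Finset.sum_le_sum hpt).trans ?_
  rw [Finset.sum_add_distrib, Finset.sum_const, nsmul_eq_mul, Finset.sum_comm]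
  refine add_le_add le_rfl ?_
  have : ∀ k ∈ Finset.range L,
      (∑ i ∈ J, if (1 / 2 : ℝ) ^ (k + 1) < s i then (1 / 2 : ℝ) ^ (k + 1) else 0) ≤ B := by
    intro k hk
    rw [← Finset.sum_filter, Finset.sum_const, nsmul_eq_mul]
    exact hB k (Finset.mem_range.1 hk)
  refine (Finset.sum_le_sum this).trans ?_
  simp

section Sensitivity

variable {G : ℝ → ℝ} {C : ℝ} {d : ℕ}

/-- The sensitivity of the row `r i` among the rows `r i, …, r (t - 1)`. -/
noncomputable def blockSens (G : ℝ → ℝ) (r : ℕ → Fin d → ℤ) (i t : ℕ) : ℝ :=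
  sSup {y | ∃ x, blockModular G r i t x ≤ 1 ∧ y = G (rowDot (r i) x)}

theorem apply_rowDot_le_blockModular (hG : IsOrliczFunction G C) (r : ℕ → Fin d → ℤ) {i j t : ℕ}
    (hij : i ≤ j) (hjt : j < t) (x : Fin d → ℝ) :
    G (rowDot (r j) x) ≤ blockModular G r i t x :=
  Finset.single_le_sum (f := fun j => G (rowDot (r j) x)) (fun _ _ => hG.nonneg _)
    (Finset.mem_Ico.2 ⟨hij, hjt⟩)

theorem blockModular_mono (hG : IsOrliczFunction G C) (r : ℕ → Fin d → ℤ) {i j s t : ℕ}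
    (hij : i ≤ j) (hst : s ≤ t) (x : Fin d → ℝ) :
    blockModular G r j s x ≤ blockModular G r i t x :=
  Finset.sum_le_sum_of_subset_of_nonneg (Finset.Ico_subset_Ico hij hst) fun _ _ _ => hG.nonneg _

theorem blockModular_zero (hG : IsOrliczFunction G C) (r : ℕ → Fin d → ℤ) (i t : ℕ) :
    blockModular G r i t 0 = 0 := by
  simp [blockModular, rowDot_zero, hG.map_zero]

theorem le_blockSens (hG : IsOrliczFunction G C) (r : ℕ → Fin d → ℤ) {i t : ℕ} (hit : i < t)
    {x : Fin d → ℝ} (hx : blockModular G r i t x ≤ 1) :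
    G (rowDot (r i) x) ≤ blockSens G r i t := by
  refine le_csSup ⟨1, ?_⟩ ⟨x, hx, rfl⟩
  rintro _ ⟨y, hy, rfl⟩
  exact (apply_rowDot_le_blockModular hG r le_rfl hit y).trans hy

theorem blockSens_nonneg (hG : IsOrliczFunction G C) (r : ℕ → Fin d → ℤ) (i t : ℕ) :
    0 ≤ blockSens G r i t := by
  refine Real.sSup_nonneg ?_
  rintro _ ⟨y, -, rfl⟩
  exact hG.nonneg _

theorem blockSens_le (hG : IsOrliczFunction G C) (r : ℕ → Fin d → ℤ) {i t : ℕ} {B : ℝ}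
    (h : ∀ x, blockModular G r i t x ≤ 1 → G (rowDot (r i) x) ≤ B) : blockSens G r i t ≤ B := by
  refine csSup_le ⟨_, 0, by rw [blockModular_zero hG]; exact zero_le_one, rfl⟩ ?_
  rintro _ ⟨y, hy, rfl⟩
  exact h y hy

theorem exists_of_lt_blockSens (hG : IsOrliczFunction G C) (r : ℕ → Fin d → ℤ) {i t : ℕ} {σ : ℝ}
    (h : σ < blockSens G r i t) :
    ∃ x, blockModular G r i t x ≤ 1 ∧ σ < G (rowDot (r i) x) := by
  by_contra! hcon
  exact absurd (blockSens_le hG r hcon) (not_le.2 h)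

theorem rowDot_eq_dotProduct (a : Fin d → ℤ) (x : Fin d → ℝ) :
    rowDot a x = (fun k => (a k : ℝ)) ⬝ᵥ x := rfl

/-- Logarithm of the upper over the lower determinant bound, with ridge `σ² / (n κ²)`. As `σ ≥
1/n²`, `d! ≤ n^d` and `c ≤ n`, the ratio is at most `(n^(2b+8) κ²)^d`. -/
theorem log_ridge_bound {n d b : ℕ} (hn : 2 ≤ n) (hd : d ≤ n) {κ σ : ℝ} (hκ : 2 ≤ κ)
    (hσ : 1 / (n : ℝ) ^ 2 ≤ σ) {c : ℝ} (hc0 : 0 ≤ c) (hcn : c ≤ n) :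
    Real.log ((d.factorial : ℝ) *
      (σ ^ 2 / (n * κ ^ 2) + c * ((n : ℝ) ^ b) ^ 2) ^ d / (σ ^ 2 / (n * κ ^ 2)) ^ d) ≤
      d * ((2 * b + 8) * Real.log n + 2 * Real.log κ) := by
  have hn0 : (0 : ℝ) < n := by positivity
  have hn2 : (2 : ℝ) ≤ n := by exact_mod_cast hn
  have hκ0 : 0 < κ := by linarith
  have hσ0 : 0 < σ := lt_of_lt_of_le (by positivity) hσ
  set lam := σ ^ 2 / (n * κ ^ 2) with hlam
  have hlam0 : 0 < lam := by positivity
  have hfac : (d.factorial : ℝ) ≤ (n : ℝ) ^ d := by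
    have h1 : d.factorial ≤ d ^ d := Nat.factorial_le_pow d
    have h2 : d ^ d ≤ n ^ d := Nat.pow_le_pow_left hd d
    exact_mod_cast h1.trans h2
  have hratio : (lam + c * ((n : ℝ) ^ b) ^ 2) / lam ≤ (n : ℝ) ^ (2 * b + 7) * κ ^ 2 := by
    rw [add_div, div_self hlam0.ne']
    have h1 : 1 / σ ^ 2 ≤ (n : ℝ) ^ 4 := by
      have h2 : 1 / σ ≤ (n : ℝ) ^ 2 := by
        rw [div_le_iff₀ hσ0]
        rw [div_le_iff₀ (by positivity)] at hσ
        linarith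
      calc 1 / σ ^ 2 = (1 / σ) ^ 2 := by rw [_root_.one_div_pow]
        _ ≤ ((n : ℝ) ^ 2) ^ 2 := pow_le_pow_left₀ (by positivity) h2 2
        _ = _ := by ring
    have h3 : c * ((n : ℝ) ^ b) ^ 2 / lam ≤ (n : ℝ) ^ (2 * b + 6) * κ ^ 2 := by
      calc c * ((n : ℝ) ^ b) ^ 2 / lam
          = c * ((n : ℝ) ^ b) ^ 2 * (n * κ ^ 2) * (1 / σ ^ 2) := by
            rw [hlam]; field_simp
        _ ≤ n * ((n : ℝ) ^ b) ^ 2 * (n * κ ^ 2) * (n : ℝ) ^ 4 := by gcongr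
        _ = _ := by ring
    have h4 : (1 : ℝ) ≤ (n : ℝ) ^ (2 * b + 6) * κ ^ 2 := by
      have : (1 : ℝ) ≤ (n : ℝ) ^ (2 * b + 6) := one_le_pow₀ (by linarith)
      nlinarith
    calc 1 + c * ((n : ℝ) ^ b) ^ 2 / lam ≤ 2 * ((n : ℝ) ^ (2 * b + 6) * κ ^ 2) := by linarith
      _ ≤ n * ((n : ℝ) ^ (2 * b + 6) * κ ^ 2) := by gcongr
      _ = _ := by ring
  have htot : (d.factorial : ℝ) * (lam + c * ((n : ℝ) ^ b) ^ 2) ^ d / lam ^ d ≤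
      ((n : ℝ) ^ (2 * b + 8) * κ ^ 2) ^ d := by
    rw [mul_div_assoc, ← div_pow]
    calc (d.factorial : ℝ) * ((lam + c * ((n : ℝ) ^ b) ^ 2) / lam) ^ d
        ≤ (n : ℝ) ^ d * ((n : ℝ) ^ (2 * b + 7) * κ ^ 2) ^ d := by gcongr
      _ = _ := by rw [← mul_pow]; ring
  have hpos : 0 < (d.factorial : ℝ) * (lam + c * ((n : ℝ) ^ b) ^ 2) ^ d / lam ^ d := by
    have : 0 < d.factorial := Nat.factorial_pos d
    positivity
  refine (Real.log_le_log hpos htot).trans ?_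
  rw [Real.log_pow, Real.log_mul (by positivity) (by positivity), Real.log_pow, Real.log_pow]
  push_cast
  exact le_rfl

/-- Weak `ℓ¹` bound: few rows have large sensitivity among the rows that follow them. -/
theorem card_lt_blockSens_mul_le (hG : IsOrliczFunction G C) (r : ℕ → Fin d → ℤ) {n b t : ℕ}
    (hn : 2 ≤ n) (hd : d ≤ n) (ht : t ≤ n) (hr : ∀ i < t, ∀ k, |r i k| ≤ (n : ℤ) ^ b) {κ σ : ℝ}
    (hκ : 2 ≤ κ) (hcond : ∀ i < t, conditionNumber (rowBlock r i t) ≤ κ)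
    (hσ : 1 / (n : ℝ) ^ 2 ≤ σ) (hσ1 : σ ≤ 1) :
    (({i ∈ Finset.range t | σ < blockSens G r i t} : Finset ℕ).card : ℝ) * σ ≤
      3 * (d * ((2 * b + 8) * Real.log n + 2 * Real.log κ) / Real.log (1 + 1 / (2 * C))) := by
  have hC := hG.one_le_const
  have hn0 : (0 : ℝ) < n := by positivity
  have hκ0 : 0 < κ := by linarith
  have hσ0 : 0 < σ := lt_of_lt_of_le (by positivity) hσ
  set J : Finset ℕ := {i ∈ Finset.range t | σ < blockSens G r i t} with hJ
  have hJt : ∀ i ∈ J, i < t := fun i hi => Finset.mem_range.1 (Finset.mem_filter.1 hi).1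
  -- Each witness is replaced by one with the same inner products and Euclidean norm controlled
  -- through `κ`.
  have hex : ∀ i : ℕ, ∃ x : Fin d → ℝ, i ∈ J → blockModular G r i t x ≤ 1 ∧
      σ < G (rowDot (r i) x) ∧
      ∑ k, x k ^ 2 ≤ κ ^ 2 * ∑ j ∈ Finset.Ico i t, rowDot (r j) x ^ 2 := by
    intro i
    by_cases hi : i ∈ J
    · obtain ⟨x, hx1, hx2⟩ := exists_of_lt_blockSens hG r (Finset.mem_filter.1 hi).2
      obtain ⟨y, hy1, hy2⟩ := exists_rowDot_eq_sum_sq_le r i t hκ0 (hcond i (hJt i hi)) x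
      refine ⟨y, fun _ => ⟨?_, ?_, ?_⟩⟩
      · refine le_of_eq_of_le (Finset.sum_congr rfl fun j hj => ?_) hx1
        rw [hy1 j hj]
      · rwa [hy1 i (Finset.mem_Ico.2 ⟨le_rfl, hJt i hi⟩)]
      · refine hy2.trans_eq (congrArg _ (Finset.sum_congr rfl fun j hj => ?_))
        rw [hy1 j hj]
    · exact ⟨0, fun h => absurd h hi⟩
  choose X hX using hex
  have hne : ∀ i ∈ J, rowDot (r i) (X i) ≠ 0 := fun i hi =>
    hG.ne_zero_of_pos (hσ0.trans (hX i hi).2.1)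
  -- The conflict of witness `i` with row `j`: a normalised square, set to `1` when row `j` has the
  -- larger inner product. In both cases `σ` times the conflict is at most the modular contribution
  -- of row `j`.
  set a : ℕ → ℕ → ℝ := fun i j =>
    if |rowDot (r i) (X i)| < |rowDot (r j) (X i)| then 1
    else rowDot (r j) (X i) ^ 2 / (C * rowDot (r i) (X i) ^ 2) with ha
  have ha0 : ∀ i j, 0 ≤ a i j := fun i j => by
    simp only [ha]; split_ifs <;> positivity
  have haσ : ∀ i ∈ J, ∀ j, a i j * σ ≤ G (rowDot (r j) (X i)) := by
    intro i hi j
    have hσi := (hX i hi).2.1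
    simp only [ha]
    split_ifs with h
    · rw [one_mul]; exact hσi.le.trans (hG.mono_abs h.le)
    · have h1 := hG.div_le_sq (hne i hi) (not_lt.1 h)
      have h2 : 0 < C * rowDot (r i) (X i) ^ 2 := by have := hne i hi; positivity
      rw [div_mul_eq_mul_div, div_le_iff₀ h2]
      have h3 := mul_le_mul_of_nonneg_right hσi.le (sq_nonneg (rowDot (r j) (X i)))
      linarith
  have hsum : ∀ i ∈ J, ∑ j ∈ J with i < j, a i j ≤ 1 / σ := by
    intro i hi
    rw [le_div_iff₀ hσ0, Finset.sum_mul]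
    refine (Finset.sum_le_sum fun j _ => haσ i hi j).trans ?_
    refine (Finset.sum_le_sum_of_subset_of_nonneg (t := Finset.Ico i t) ?_
      fun _ _ _ => hG.nonneg _).trans (hX i hi).1
    intro j hj
    rw [Finset.mem_filter] at hj
    exact Finset.mem_Ico.2 ⟨hj.2.le, hJt j hj.1⟩
  -- With this many colours the conflicts inside a class sum to at most `1/2`, which rules out the
  -- value `1`; only the quadratic case of `a` is left.
  set m := ⌈2 / σ⌉₊ with hm
  have hm0 : 0 < m := Nat.ceil_pos.2 (by positivity)
  have hm1 : 2 / σ ≤ m := Nat.le_ceil _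
  have hm2 : (m : ℝ) * σ ≤ 3 := by
    have h1 : (m : ℝ) ≤ 2 / σ + 1 := (Nat.ceil_lt_add_one (by positivity)).le
    calc (m : ℝ) * σ ≤ (2 / σ + 1) * σ := by gcongr
      _ = 2 + σ := by field_simp
      _ ≤ 3 := by linarith
  obtain ⟨f, hf⟩ := exists_coloring J a hm0 hsum
  have hhalf : 1 / σ / m ≤ 1 / 2 := by
    rw [div_le_iff₀ (by positivity)]
    have : 1 / σ = 1 / 2 * (2 / σ) := by ring
    rw [this]; gcongr
  set ℓ := Real.log (1 + 1 / (2 * C)) with hℓ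
  have hℓ0 : 0 < ℓ := Real.log_pos (by
    have : 0 < 1 / (2 * C) := by positivity
    linarith)
  set lam := σ ^ 2 / (n * κ ^ 2) with hlam
  have hlam0 : 0 < lam := by positivity
  have hclass : ∀ c : Fin m, (({i ∈ J | f i = c} : Finset ℕ).card : ℝ) ≤
      d * ((2 * b + 8) * Real.log n + 2 * Real.log κ) / ℓ := by
    intro c
    set Jc : Finset ℕ := {i ∈ J | f i = c} with hJc
    -- The class contributes at most `(C/2) y²` and the ridge at most `y²`; together this is below
    -- `2 C y²` because `C ≥ 1`.
    have hlow := pow_card_le_det_ridgeGram (d := d) (Γ := 2 * C) hlam0 (by positivity)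
      (fun j k => (r j k : ℝ)) Jc (by
        intro i hi
        obtain ⟨hiJ, hic⟩ := Finset.mem_filter.1 hi
        refine ⟨X i, hne i hiJ, ?_⟩
        have hset : ({j ∈ Jc | i < j} : Finset ℕ) = {j ∈ J | i < j ∧ f j = f i} := by
          ext j
          simp only [hJc, Finset.mem_filter, hic]
          tauto
        rw [hset]
        have hfi := (hf i hiJ).trans hhalf
        set y := rowDot (r i) (X i) with hy
        have hy2 : 0 < y ^ 2 := by have := hne i hiJ; positivity
        have hsmall : ∀ j ∈ ({j ∈ J | i < j ∧ f j = f i} : Finset ℕ),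
            rowDot (r j) (X i) ^ 2 = C * y ^ 2 * a i j := by
          intro j hj
          have h1 : a i j ≤ 1 / 2 :=
            (Finset.single_le_sum (f := fun j => a i j) (fun _ _ => ha0 i _) hj).trans hfi
          simp only [ha] at h1 ⊢
          split_ifs at h1 ⊢ with h
          · norm_num at h1
          · rw [← hy, mul_div_cancel₀ _ (mul_pos (by linarith) hy2).ne']
        have h1 : ∑ j ∈ J with i < j ∧ f j = f i, rowDot (r j) (X i) ^ 2 ≤ C * y ^ 2 * (1 / 2) := by
          rw [Finset.sum_congr rfl hsmall, ← Finset.mul_sum]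
          gcongr
        -- If `|⟨r_j, x_i⟩|` exceeded `|y| / σ`, convexity and modular at most `1` would give `G y <
        -- σ`. This bounds `‖x_i‖` and explains the choice of `lam`.
        have hbig : ∀ j ∈ Finset.Ico i t, rowDot (r j) (X i) ^ 2 ≤ y ^ 2 / σ ^ 2 := by
          intro j hj
          obtain ⟨hj1, hj2⟩ := Finset.mem_Ico.1 hj
          rw [← div_pow, ← sq_abs, ← sq_abs (y / σ), abs_div, abs_of_pos hσ0]
          refine pow_le_pow_left₀ (abs_nonneg _) ?_ 2
          by_contra hcon
          rw [not_le, div_lt_iff₀ hσ0] at hcon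
          have hz : 0 < |rowDot (r j) (X i)| := by
            by_contra h0
            have : |rowDot (r j) (X i)| = 0 := le_antisymm (not_lt.1 h0) (abs_nonneg _)
            rw [this, zero_mul] at hcon
            exact absurd hcon (not_lt.2 (abs_nonneg _))
          have h2 : |y| / |rowDot (r j) (X i)| < σ := by
            rw [div_lt_iff₀ hz]; linarith
          have h3 := hG.mul_le |rowDot (r j) (X i)| (t := |y| / |rowDot (r j) (X i)|)
            (by positivity) (by linarith)
          rw [div_mul_cancel₀ _ hz.ne', hG.apply_abs, hG.apply_abs] at h3
          have h4 := (apply_rowDot_le_blockModular hG r hj1 hj2 (X i)).trans (hX i hiJ).1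
          have h5 : |y| / |rowDot (r j) (X i)| * G (rowDot (r j) (X i)) ≤
              |y| / |rowDot (r j) (X i)| * 1 := by gcongr
          linarith [(hX i hiJ).2.1]
        have h6 : lam * ∑ k, X i k ^ 2 ≤ y ^ 2 := by
          have h7 : ∑ j ∈ Finset.Ico i t, rowDot (r j) (X i) ^ 2 ≤ n * (y ^ 2 / σ ^ 2) := by
            refine (Finset.sum_le_card_nsmul _ _ _ hbig).trans ?_
            rw [nsmul_eq_mul, Nat.card_Ico]
            gcongr
            omega
          calc lam * ∑ k, X i k ^ 2 ≤ lam * (κ ^ 2 * (n * (y ^ 2 / σ ^ 2))) := by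
                have := (hX i hiJ).2.2
                gcongr
                exact this.trans (by gcongr)
            _ = y ^ 2 := by rw [hlam]; field_simp
        simp only [← rowDot_eq_dotProduct]
        rw [← hy]
        nlinarith)
    have hJcn : (Jc.card : ℝ) ≤ n := by
      have h1 : Jc.card ≤ t := by
        have := Finset.card_le_card (s := Jc) (t := Finset.range t) fun i hi =>
          Finset.mem_range.2 (hJt i (Finset.mem_filter.1 hi).1)
        rwa [Finset.card_range] at this
      exact_mod_cast h1.trans ht
    have hup := det_ridgeGram_le (d := d) (M := (n : ℝ) ^ b) hlam0 (fun j k => (r j k : ℝ)) Jc (by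
      intro j hj k
      have := hr j (hJt j (Finset.mem_filter.1 hj).1) k
      exact_mod_cast this)
    have hcomb := hlow.trans hup
    have h1 : (1 + 1 / (2 * C)) ^ Jc.card ≤ (d.factorial : ℝ) *
        (lam + Jc.card * ((n : ℝ) ^ b) ^ 2) ^ d / lam ^ d := by
      rw [le_div_iff₀ (by positivity)]; linarith
    have h2 := Real.log_le_log (by positivity) h1
    rw [Real.log_pow] at h2
    rw [le_div_iff₀ hℓ0]
    exact h2.trans (log_ridge_bound hn hd hκ hσ (by positivity) hJcn)
  have hcard : (J.card : ℝ) ≤ m * (d * ((2 * b + 8) * Real.log n + 2 * Real.log κ) / ℓ) := by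
    rw [Finset.card_eq_sum_card_fiberwise (f := f) (t := Finset.univ) fun _ _ => Finset.mem_univ _]
    push_cast
    refine (Finset.sum_le_card_nsmul _ _ _ fun c _ => hclass c).trans ?_
    simp
  have hnn : 0 ≤ d * ((2 * b + 8) * Real.log n + 2 * Real.log κ) / ℓ := by
    have h1 : 0 ≤ Real.log n := Real.log_nonneg (by exact_mod_cast (by omega : 1 ≤ n))
    have h2 : 0 ≤ Real.log κ := Real.log_nonneg (by linarith)
    positivity
  calc (J.card : ℝ) * σ ≤ m * (d * ((2 * b + 8) * Real.log n + 2 * Real.log κ) / ℓ) * σ := by gcongr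
    _ = m * σ * (d * ((2 * b + 8) * Real.log n + 2 * Real.log κ) / ℓ) := by ring
    _ ≤ _ := by gcongr

/-- The total sensitivity of the rows of a stream, each among the rows that follow it. -/
theorem sum_blockSens_le (hG : IsOrliczFunction G C) (r : ℕ → Fin d → ℤ) {n b t : ℕ}
    (hn : 2 ≤ n) (hd : d ≤ n) (ht : t ≤ n) (hr : ∀ i < t, ∀ k, |r i k| ≤ (n : ℤ) ^ b) {κ : ℝ}
    (hκ : 2 ≤ κ) (hcond : ∀ i < t, conditionNumber (rowBlock r i t) ≤ κ) :
    ∑ i ∈ Finset.range t, blockSens G r i t ≤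
      1 + 3 * Real.log n *
        (3 * (d * ((2 * b + 8) * Real.log n + 2 * Real.log κ) / Real.log (1 + 1 / (2 * C)))) := by
  have hC := hG.one_le_const
  have hn0 : (0 : ℝ) < n := by positivity
  have hn2 : (2 : ℝ) ≤ n := by exact_mod_cast hn
  -- The number of dyadic levels: `n ≤ 2^L` makes the remainder at most `1`, and `2^L ≤ n²` keeps
  -- every threshold above `1/n²`.
  set L := Nat.log 2 n + 1 with hL
  have hL1 : n < 2 ^ L := Nat.lt_pow_succ_log_self (by norm_num) n
  have hL2 : 2 ^ L ≤ n ^ 2 := by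
    have := Nat.pow_log_le_self 2 (x := n) (by omega)
    rw [hL, pow_succ]; nlinarith
  have hL1' : (n : ℝ) ≤ 2 ^ L := by exact_mod_cast hL1.le
  have hL2' : (2 : ℝ) ^ L ≤ (n : ℝ) ^ 2 := by exact_mod_cast hL2
  have hlog2 : 0.69 < Real.log 2 := by linarith [Real.log_two_gt_d9]
  have hLlog : (L : ℝ) ≤ 3 * Real.log n := by
    have h1 := Real.log_le_log (by positivity) hL2'
    rw [Real.log_pow, Real.log_pow] at h1
    push_cast at h1
    have h2 : (0 : ℝ) ≤ L := by positivity
    nlinarith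
  set B := 3 * (d * ((2 * b + 8) * Real.log n + 2 * Real.log κ) / Real.log (1 + 1 / (2 * C)))
    with hB
  have hB0 : 0 ≤ B := by
    have h1 : 0 ≤ Real.log n := Real.log_nonneg (by linarith)
    have h2 : 0 ≤ Real.log κ := Real.log_nonneg (by linarith)
    have h3 : 0 ≤ Real.log (1 + 1 / (2 * C)) := Real.log_nonneg (by
      have : 0 < 1 / (2 * C) := by positivity
      linarith)
    positivity
  refine (sum_le_of_card_superlevel_le (B := B) _ _ L (fun i hi => ?_) fun k hk => ?_).trans ?_
  · exact blockSens_le hG r fun x hx =>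
      (apply_rowDot_le_blockModular hG r le_rfl (Finset.mem_range.1 hi) x).trans hx
  · refine card_lt_blockSens_mul_le hG r hn hd ht hr hκ hcond ?_ ?_
    · rw [_root_.one_div_pow]
      refine one_div_le_one_div_of_le (by positivity) (le_trans ?_ hL2')
      exact pow_le_pow_right₀ (by norm_num) (by omega)
    · exact pow_le_one₀ (by norm_num) (by norm_num)
  · refine add_le_add ?_ (mul_le_mul_of_nonneg_right hLlog hB0)
    rw [Finset.card_range, _root_.one_div_pow, mul_one_div, div_le_one (by positivity)]
    exact le_trans (by exact_mod_cast ht) hL1'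

end Sensitivity

/-! ### Expectations under discrete laws -/

section PMFSums

open scoped ENNReal

variable {α β : Type*}

theorem PMF.tsum_bind_mul (p : PMF α) (f : α → PMF β) (F : β → ℝ≥0∞) :
    ∑' b, p.bind f b * F b = ∑' a, p a * ∑' b, f a b * F b := by
  simp only [PMF.bind_apply, ← ENNReal.tsum_mul_right, ← ENNReal.tsum_mul_left, mul_assoc]
  exact ENNReal.tsum_comm

theorem PMF.tsum_pure_mul (a : α) (F : α → ℝ≥0∞) : ∑' b, PMF.pure a b * F b = F a := by
  rw [tsum_eq_single a fun b hb => by rw [PMF.pure_apply_of_ne _ _ hb, zero_mul],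
    PMF.pure_apply_self, one_mul]

theorem PMF.tsum_map_mul (p : PMF α) (f : α → β) (F : β → ℝ≥0∞) :
    ∑' b, p.map f b * F b = ∑' a, p a * F (f a) := by
  rw [← PMF.bind_pure_comp, PMF.tsum_bind_mul]
  simp only [Function.comp_apply, PMF.tsum_pure_mul]

end PMFSums

noncomputable instance SampledRow.instDecidableEq (d : ℕ) : DecidableEq (SampledRow d) :=
  Classical.decEq _

/-! ### Thinning and expectations over runs that stay good -/

section Thinning

variable {d : ℕ}

/-- The weight of a stored row after a thinning step with target weights `tgt`. -/
noncomputable def newWeight (tgt : Memory d → SampledRow d → ℝ) (S : Memory d)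
    (s : SampledRow d) : ℝ :=
  -- Weights never decrease, so the survival ratio is at most `1`.
  max s.weight (max 1 (tgt S s))

/-- The probability with which a stored row survives a thinning step. -/
noncomputable def keepProb (tgt : Memory d → SampledRow d → ℝ) (S : Memory d)
    (s : SampledRow d) : ℝ :=
  -- A step has to be a probability law for every memory, even one with negative weights; for
  -- positive weights the truncation is void.
  max 0 (s.weight / newWeight tgt S s)

/-- A stored row with its new weight. -/
noncomputable def reweight (tgt : Memory d → SampledRow d → ℝ) (S : Memory d)
    (s : SampledRow d) : SampledRow d :=
  { s with weight := newWeight tgt S s }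

/-- The memory after the arrival of the row `a` at time `t` if `T` is the set of surviving rows. -/
noncomputable def nextMemory (tgt : Memory d → SampledRow d → ℝ) (t : ℕ) (a : Fin d → ℤ)
    (S T : Memory d) : Memory d :=
  insert ⟨t, a, 1⟩ (T.image (reweight tgt S))

/-- The probability that `T` is the set of surviving rows of `S`. -/
noncomputable def thinProb (tgt : Memory d → SampledRow d → ℝ) (S T : Memory d) : ℝ :=
  (∏ s ∈ T, keepProb tgt S s) * ∏ s ∈ S \ T, (1 - keepProb tgt S s)

variable (tgt : Memory d → SampledRow d → ℝ)

theorem one_le_newWeight (S : Memory d) (s : SampledRow d) : 1 ≤ newWeight tgt S s :=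
  (le_max_left _ _).trans (le_max_right _ _)

theorem keepProb_nonneg (S : Memory d) (s : SampledRow d) : 0 ≤ keepProb tgt S s := le_max_left _ _

theorem keepProb_le_one (S : Memory d) (s : SampledRow d) : keepProb tgt S s ≤ 1 := by
  refine max_le zero_le_one (div_le_one_of_le₀ (le_max_left _ _) ?_)
  linarith [one_le_newWeight tgt S s]

/-- Unbiasedness: the expected weight of a row is unchanged by thinning. -/
theorem keepProb_mul_newWeight (S : Memory d) {s : SampledRow d} (hs : 0 < s.weight) :
    keepProb tgt S s * newWeight tgt S s = s.weight := by
  have h := one_le_newWeight tgt S s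
  rw [keepProb, max_eq_right (by positivity), div_mul_cancel₀]
  linarith

theorem thinProb_nonneg (S T : Memory d) : 0 ≤ thinProb tgt S T :=
  mul_nonneg (Finset.prod_nonneg fun _ _ => keepProb_nonneg tgt S _)
    (Finset.prod_nonneg fun _ _ => sub_nonneg.2 (keepProb_le_one tgt S _))

theorem sum_thinProb (S : Memory d) : ∑ T ∈ S.powerset, thinProb tgt S T = 1 := by
  unfold thinProb
  rw [← Finset.prod_add]
  simp

/-- The law of the set of surviving rows. -/
noncomputable def thinPMF (S : Memory d) : PMF (Memory d) :=
  PMF.ofFinset (fun T => if T ∈ S.powerset then ENNReal.ofReal (thinProb tgt S T) else 0)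
    S.powerset
    (by
      rw [Finset.sum_congr rfl fun T hT => if_pos hT,
        ← ENNReal.ofReal_sum_of_nonneg fun T _ => thinProb_nonneg tgt S T, sum_thinProb,
        ENNReal.ofReal_one])
    fun T hT => if_neg hT

theorem tsum_thinPMF_mul (S : Memory d) (F : Memory d → ENNReal) :
    ∑' T, thinPMF tgt S T * F T = ∑ T ∈ S.powerset, ENNReal.ofReal (thinProb tgt S T) * F T := by
  rw [tsum_eq_sum (s := S.powerset)]
  · refine Finset.sum_congr rfl fun T hT => ?_
    rw [thinPMF, PMF.ofFinset_apply, if_pos hT]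
  · intro T hT
    rw [thinPMF, PMF.ofFinset_apply, if_neg hT, zero_mul]

/-- The row-sampling algorithm that, on the arrival of a row, thins the stored rows independently to
the target weights and then stores the new row with weight `1`. -/
noncomputable def thinningSampler : RowSampler d where
  step t S a := (thinPMF tgt S).map (nextMemory tgt t a S)
  step_spec := by
    intro t S a S' hS' s hs
    obtain ⟨T, hT, rfl⟩ := (PMF.mem_support_map_iff _ _ _).1 hS'
    have hTS : T ⊆ S := by
      by_contra h
      refine (PMF.mem_support_iff _ _).1 hT ?_
      rw [thinPMF, PMF.ofFinset_apply, if_neg (by simpa using h)]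
    rcases Finset.mem_insert.1 hs with rfl | hs
    · exact ⟨one_pos, Or.inl ⟨rfl, rfl⟩⟩
    · obtain ⟨s₀, hs₀, rfl⟩ := Finset.mem_image.1 hs
      exact ⟨lt_of_lt_of_le one_pos (one_le_newWeight tgt S s₀),
        Or.inr ⟨s₀, hTS hs₀, rfl, rfl⟩⟩

/-- The expectation of `F` after one step of the sampler. -/
noncomputable def thinExp (t : ℕ) (a : Fin d → ℤ) (F : Memory d → ℝ) (S : Memory d) : ℝ :=
  ∑ T ∈ S.powerset, thinProb tgt S T * F (nextMemory tgt t a S T)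

theorem tsum_thinningSampler_step_mul (t : ℕ) (a : Fin d → ℤ) (S : Memory d) (F : Memory d → ℝ)
    (hF : ∀ S, 0 ≤ F S) :
    ∑' S', (thinningSampler tgt).step t S a S' * ENNReal.ofReal (F S') =
      ENNReal.ofReal (thinExp tgt t a F S) := by
  simp only [thinningSampler]
  rw [PMF.tsum_map_mul, tsum_thinPMF_mul, thinExp,
    ENNReal.ofReal_sum_of_nonneg fun T _ => mul_nonneg (thinProb_nonneg tgt S T) (hF _)]
  exact Finset.sum_congr rfl fun T _ => (ENNReal.ofReal_mul (thinProb_nonneg tgt S T)).symm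

theorem thinExp_mono (t : ℕ) (a : Fin d → ℤ) {F F' : Memory d → ℝ} {S : Memory d}
    (h : ∀ T ⊆ S, F (nextMemory tgt t a S T) ≤ F' (nextMemory tgt t a S T)) :
    thinExp tgt t a F S ≤ thinExp tgt t a F' S :=
  Finset.sum_le_sum fun T hT => mul_le_mul_of_nonneg_left (h T (Finset.mem_powerset.1 hT))
    (thinProb_nonneg tgt S T)

theorem thinExp_const (t : ℕ) (a : Fin d → ℤ) (c : ℝ) (S : Memory d) :
    thinExp tgt t a (fun _ => c) S = c := by
  rw [thinExp, ← Finset.sum_mul, sum_thinProb, one_mul]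

theorem thinExp_add (t : ℕ) (a : Fin d → ℤ) (F F' : Memory d → ℝ) (S : Memory d) :
    thinExp tgt t a (fun S => F S + F' S) S = thinExp tgt t a F S + thinExp tgt t a F' S := by
  simp only [thinExp, mul_add, Finset.sum_add_distrib]

theorem thinExp_mul (t : ℕ) (a : Fin d → ℤ) (c : ℝ) (F : Memory d → ℝ) (S : Memory d) :
    thinExp tgt t a (fun S => c * F S) S = c * thinExp tgt t a F S := by
  simp only [thinExp, Finset.mul_sum, mul_left_comm]

/-- Bookkeeping invariant of the memory before time `t`: every stored row arrived earlier, at most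
one per time, and has positive weight. -/
structure Memory.WellFormed (t : ℕ) (S : Memory d) : Prop where
  time_lt : ∀ s ∈ S, s.time < t
  injOn : Set.InjOn SampledRow.time (S : Set (SampledRow d))
  weight_pos : ∀ s ∈ S, 0 < s.weight

theorem Memory.WellFormed.nextMemory {t : ℕ} {S T : Memory d} (h : S.WellFormed t) (hT : T ⊆ S)
    (a : Fin d → ℤ) : (nextMemory tgt t a S T).WellFormed (t + 1) := by
  refine ⟨fun s hs => ?_, fun s hs s' hs' hss' => ?_, fun s hs => ?_⟩
  · rcases Finset.mem_insert.1 hs with rfl | hs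
    · exact Nat.lt_succ_self t
    · obtain ⟨s₀, hs₀, rfl⟩ := Finset.mem_image.1 hs
      exact Nat.lt_succ_of_lt (h.time_lt s₀ (hT hs₀))
  · rcases Finset.mem_insert.1 hs with rfl | hs <;> rcases Finset.mem_insert.1 hs' with rfl | hs'
    · rfl
    · obtain ⟨s₀, hs₀, rfl⟩ := Finset.mem_image.1 hs'
      exact absurd hss' (h.time_lt s₀ (hT hs₀)).ne'
    · obtain ⟨s₀, hs₀, rfl⟩ := Finset.mem_image.1 hs
      exact absurd hss' (h.time_lt s₀ (hT hs₀)).ne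
    · obtain ⟨s₀, hs₀, rfl⟩ := Finset.mem_image.1 hs
      obtain ⟨s₁, hs₁, rfl⟩ := Finset.mem_image.1 hs'
      rw [h.injOn (hT hs₀) (hT hs₁) hss']
  · rcases Finset.mem_insert.1 hs with rfl | hs
    · exact one_pos
    · obtain ⟨s₀, hs₀, rfl⟩ := Finset.mem_image.1 hs
      exact lt_of_lt_of_le one_pos (one_le_newWeight tgt S s₀)

/-- The product potential `∏ (1 + c · w)` over the stored rows. -/
noncomputable def prodPotential (c : ℕ → ℝ) (S : Memory d) : ℝ :=
  ∏ s ∈ S, (1 + c s.time * s.weight)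

/-- Thinning preserves the expectation of a product potential; the new row contributes a factor. -/
theorem thinExp_prodPotential (c : ℕ → ℝ) {t : ℕ} {S : Memory d} (h : S.WellFormed t)
    (a : Fin d → ℤ) :
    thinExp tgt t a (prodPotential c) S = (1 + c t) * prodPotential c S := by
  have hnext : ∀ T ∈ S.powerset, prodPotential c (nextMemory tgt t a S T) =
      (1 + c t) * ∏ s ∈ T, (1 + c s.time * newWeight tgt S s) := by
    intro T hT
    have hTS := Finset.mem_powerset.1 hT
    rw [prodPotential, nextMemory, Finset.prod_insert, Finset.prod_image]
    · simp only [reweight, mul_one]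
    · intro s hs s' hs' hss'
      have htime : (reweight tgt S s).time = (reweight tgt S s').time := congrArg _ hss'
      exact h.injOn (hTS hs) (hTS hs') htime
    · intro hmem
      obtain ⟨s₀, hs₀, hs₁⟩ := Finset.mem_image.1 hmem
      exact absurd (congrArg SampledRow.time hs₁) (h.time_lt s₀ (hTS hs₀)).ne
  have hkey : prodPotential c S = ∑ T ∈ S.powerset,
      thinProb tgt S T * ∏ s ∈ T, (1 + c s.time * newWeight tgt S s) := by
    -- By unbiasedness each factor is its own average over survival and deletion; expanding the
    -- product gives the sum over surviving sets.
    have h1 : prodPotential c S = ∏ s ∈ S,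
        (keepProb tgt S s * (1 + c s.time * newWeight tgt S s) + (1 - keepProb tgt S s)) := by
      refine Finset.prod_congr rfl fun s hs => ?_
      have := keepProb_mul_newWeight tgt S (h.weight_pos s hs)
      linear_combination c s.time * (-this)
    rw [h1, Finset.prod_add]
    refine Finset.sum_congr rfl fun T _ => ?_
    rw [Finset.prod_mul_distrib, thinProb]
    ring
  rw [hkey, thinExp, Finset.mul_sum]
  refine Finset.sum_congr rfl fun T hT => ?_
  rw [hnext T hT]
  ring

open Classical in
/-- The expectation of `F` over the runs of the sampler that satisfy `Good` at all times before
`t`. -/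
noncomputable def killedExp (r : ℕ → Fin d → ℤ) (Good : ℕ → Memory d → Prop) :
    ℕ → (Memory d → ℝ) → ℝ
  | 0, F => F ∅
  | t + 1, F => killedExp r Good t fun S => if Good t S then thinExp tgt t (r t) F S else 0

variable (r : ℕ → Fin d → ℤ) (Good : ℕ → Memory d → Prop)

theorem killedExp_add (t : ℕ) (F F' : Memory d → ℝ) :
    killedExp tgt r Good t (fun S => F S + F' S) =
      killedExp tgt r Good t F + killedExp tgt r Good t F' := by
  classical
  induction t generalizing F F' with
  | zero => rfl
  | succ t ih =>
    simp only [killedExp]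
    rw [← ih]
    congr 1
    ext S
    split_ifs
    · exact thinExp_add tgt t (r t) F F' S
    · simp

theorem killedExp_mul (t : ℕ) (c : ℝ) (F : Memory d → ℝ) :
    killedExp tgt r Good t (fun S => c * F S) = c * killedExp tgt r Good t F := by
  classical
  induction t generalizing F with
  | zero => rfl
  | succ t ih =>
    simp only [killedExp]
    rw [← ih]
    congr 1
    ext S
    split_ifs
    · exact thinExp_mul tgt t (r t) c F S
    · simp

theorem killedExp_sum {ι : Type*} (t : ℕ) (I : Finset ι) (F : ι → Memory d → ℝ) :
    killedExp tgt r Good t (fun S => ∑ i ∈ I, F i S) =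
      ∑ i ∈ I, killedExp tgt r Good t (F i) := by
  classical
  induction I using Finset.induction_on with
  | empty =>
    have := killedExp_mul tgt r Good t 0 fun _ => 0
    simpa using this
  | insert i I hi ih =>
    simp only [Finset.sum_insert hi]
    rw [killedExp_add, ih]

/-- `killedExp` is monotone with respect to inequalities on an invariant. -/
theorem killedExp_mono {Inv : ℕ → Memory d → Prop} (h0 : Inv 0 ∅)
    (hstep : ∀ t S, Inv t S → Good t S → ∀ T ⊆ S, Inv (t + 1) (nextMemory tgt t (r t) S T))
    {t : ℕ} {F F' : Memory d → ℝ} (h : ∀ S, Inv t S → F S ≤ F' S) :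
    killedExp tgt r Good t F ≤ killedExp tgt r Good t F' := by
  classical
  induction t generalizing F F' with
  | zero => exact h ∅ h0
  | succ t ih =>
    simp only [killedExp]
    refine ih fun S hS => ?_
    split_ifs with hg
    · exact thinExp_mono tgt t (r t) fun T hT => h _ (hstep t S hS hg T hT)
    · exact le_rfl

/-- A step multiplies the expected potential by `1 + c t`, and discarding bad runs can only lower
it, since the potential is nonnegative under the invariant. -/
theorem killedExp_prodPotential_le {Inv : ℕ → Memory d → Prop} (h0 : Inv 0 ∅)
    (hstep : ∀ t S, Inv t S → Good t S → ∀ T ⊆ S, Inv (t + 1) (nextMemory tgt t (r t) S T))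
    (hwf : ∀ t S, Inv t S → S.WellFormed t) (c : ℕ → ℝ) (t : ℕ)
    (hc : ∀ u ≤ t, ∀ S, Inv u S → ∀ s ∈ S, 0 ≤ 1 + c s.time * s.weight)
    (hc' : ∀ u < t, 0 ≤ 1 + c u) :
    killedExp tgt r Good t (prodPotential c) ≤ ∏ u ∈ Finset.range t, (1 + c u) := by
  classical
  induction t with
  | zero => simp [killedExp, prodPotential]
  | succ t ih =>
    have ih' := ih (fun u hu => hc u (by omega)) fun u hu => hc' u (by omega)
    have hct := hc' t (by omega)
    rw [Finset.prod_range_succ, mul_comm]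
    refine le_trans ?_ (mul_le_mul_of_nonneg_left ih' hct)
    rw [← killedExp_mul, killedExp]
    refine killedExp_mono tgt r Good h0 hstep fun S hS => ?_
    have hS0 : 0 ≤ prodPotential c S := Finset.prod_nonneg fun s hs => hc t (by omega) S hS s hs
    split_ifs
    · exact (thinExp_prodPotential tgt c (hwf t S hS) (r t)).le
    · positivity

theorem tsum_run_succ_mul (alg : RowSampler d) (m : ℕ) (H : Memory d × ℕ → ENNReal) :
    ∑' p, alg.run r (m + 1) p * H p = ∑' p, alg.run r m p *
      ∑' S, alg.step m p.1 (r m) S * H (S, max p.2 S.card) := by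
  simp only [RowSampler.run]
  rw [PMF.tsum_bind_mul]
  simp only [PMF.tsum_map_mul]

open Classical in
/-- The probability that a run exceeds the memory bound or ends in a bad state is at most the sum of
the probabilities that it becomes bad for the first time at a given time. -/
theorem tsum_run_le_killedExp {cap : ℝ} (hcap : 0 ≤ cap)
    (hGood : ∀ t S, Good t S → (S.card : ℝ) ≤ cap) (t : ℕ) (h : Memory d → ℝ)
    (h0 : ∀ S, 0 ≤ h S) (h1 : ∀ S, h S ≤ 1) (hh : ∀ S : Memory d, cap < S.card → h S = 1) :
    ∑' p, (thinningSampler tgt).run r t p *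
        ENNReal.ofReal (if cap < p.2 then 1 else h p.1) ≤
      ENNReal.ofReal (killedExp tgt r Good t h +
        ∑ u ∈ Finset.range t, killedExp tgt r Good u fun S => if Good u S then 0 else 1) := by
  induction t generalizing h with
  | zero =>
    simp only [RowSampler.run, PMF.tsum_pure_mul, killedExp, Finset.range_zero, Finset.sum_empty,
      add_zero, Nat.cast_zero, if_neg (not_lt.2 hcap)]
    exact le_rfl
  | succ t ih =>
    rw [tsum_run_succ_mul]
    -- The cost one step earlier: a bad state is charged `1` at once. A memory overflow is itself
    -- bad, so the recorded maximum needs no separate treatment.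
    set h' : Memory d → ℝ := fun S => if Good t S then thinExp tgt t (r t) h S else 1 with hh'
    have ht0 : ∀ S, 0 ≤ thinExp tgt t (r t) h S := fun S =>
      (thinExp_const tgt t (r t) 0 S).symm.le.trans (thinExp_mono tgt t (r t) fun _ _ => h0 _)
    have ht1 : ∀ S, thinExp tgt t (r t) h S ≤ 1 := fun S =>
      (thinExp_mono tgt t (r t) fun _ _ => h1 _).trans (thinExp_const tgt t (r t) 1 S).le
    have hstep := ih h' (fun S => by simp only [hh']; split_ifs; exacts [ht0 S, zero_le_one])
      (fun S => by simp only [hh']; split_ifs; exacts [ht1 S, le_rfl])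
      (fun S hS => by
        simp only [hh']
        rw [if_neg fun hg => absurd (hGood t S hg) (not_le.2 hS)])
    refine (ENNReal.tsum_le_tsum fun p => mul_le_mul_right ?_ _).trans (hstep.trans_eq ?_)
    · by_cases hp : cap < p.2
      · have : ∀ S : Memory d, cap < ((max p.2 S.card : ℕ) : ℝ) := fun S =>
          hp.trans_le (by exact_mod_cast le_max_left _ _)
        simp only [this, if_true, hp]
        rw [tsum_thinningSampler_step_mul tgt t (r t) p.1 (fun _ => 1) fun _ => zero_le_one,
          thinExp_const]
      · have : ∀ S : Memory d, (if cap < ((max p.2 S.card : ℕ) : ℝ) then 1 else h S) = h S := by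
          intro S
          split_ifs with hS
          · rw [Nat.cast_max, lt_max_iff] at hS
            exact (hh S (hS.resolve_left hp)).symm
          · rfl
        simp only [this, hp, if_false]
        rw [tsum_thinningSampler_step_mul tgt t (r t) p.1 h h0]
        refine ENNReal.ofReal_le_ofReal ?_
        simp only [hh']
        split_ifs
        exacts [le_rfl, ht1 _]
    · rw [Finset.sum_range_succ, killedExp]
      congr 1
      have : h' = fun S => (if Good t S then thinExp tgt t (r t) h S else 0) +
          if Good t S then (0 : ℝ) else 1 := by
        ext S
        simp only [hh']
        split_ifs <;> simp
      rw [this, killedExp_add]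
      ring

end Thinning

/-! ### Exponential estimates for one row -/

section Chernoff

/-- The slope of the chord of `exp (θ y)` over `[0, max g β]`, times `g`. -/
noncomputable def chernoffCoef (θ β g : ℝ) : ℝ := g * ((Real.exp (θ * max g β) - 1) / max g β)

theorem exp_le_chord (θ : ℝ) {y m : ℝ} (hy : 0 ≤ y) (hm : 0 < m) (hym : y ≤ m) :
    Real.exp (θ * y) ≤ 1 + y * ((Real.exp (θ * m) - 1) / m) := by
  have h := convexOn_exp.2 (Set.mem_univ (θ * m)) (Set.mem_univ 0)
    (show 0 ≤ y / m by positivity) (show 0 ≤ 1 - y / m from sub_nonneg.2 ((div_le_one hm).2 hym))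
    (by ring)
  simp only [smul_eq_mul, mul_zero, add_zero, Real.exp_zero, mul_one] at h
  rw [show y / m * (θ * m) = θ * y by field_simp] at h
  refine h.trans_eq ?_
  field_simp
  ring

/-- Both alternatives put `w g` into `[0, max g β]`, where the chord lies above the exponential.
Being affine in `w`, the chord fits the product potential; the maximum with `g` admits rows heavier
than `β` that are still kept with weight `1`. -/
theorem exp_le_one_add_chernoffCoef_mul (θ : ℝ) {β g w : ℝ} (hβ : 0 < β) (hg : 0 ≤ g) (hw : 1 ≤ w)
    (h : w = 1 ∨ w * g ≤ β) : Real.exp (θ * (w * g)) ≤ 1 + chernoffCoef θ β g * w := by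
  have hm : 0 < max g β := hβ.trans_le (le_max_right _ _)
  have hwg : w * g ≤ max g β := by
    rcases h with rfl | h
    · rw [one_mul]; exact le_max_left _ _
    · exact h.trans (le_max_right _ _)
  refine (exp_le_chord θ (by positivity) hm hwg).trans_eq ?_
  rw [chernoffCoef]; ring

/-- If `g ≥ β` the left side is exactly `exp (θ g)`; otherwise `|exp u - 1 - u| ≤ u²` for `|u| ≤ 1`
applies. -/
theorem one_add_chernoffCoef_le (θ : ℝ) {β g : ℝ} (hβ : 0 < β) (hg : 0 ≤ g) (hθ : |θ * β| ≤ 1) :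
    1 + chernoffCoef θ β g ≤ Real.exp ((θ + θ ^ 2 * β) * g) := by
  unfold chernoffCoef
  rcases le_total β g with h | h
  · rw [max_eq_left h, mul_div_cancel₀ _ (hβ.trans_le h).ne', add_sub_cancel]
    refine Real.exp_le_exp.2 (mul_le_mul_of_nonneg_right ?_ hg)
    have : 0 ≤ θ ^ 2 * β := by positivity
    linarith
  · rw [max_eq_right h]
    have h1 := (abs_le.1 (Real.abs_exp_sub_one_sub_id_le hθ)).2
    have h2 : (Real.exp (θ * β) - 1) / β ≤ θ + θ ^ 2 * β := by
      rw [div_le_iff₀ hβ]; nlinarith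
    have h3 := mul_le_mul_of_nonneg_left h2 hg
    have h4 := Real.add_one_le_exp ((θ + θ ^ 2 * β) * g)
    linarith

end Chernoff

/-! ### The sampler and its calibration invariant -/

section Sampler

variable {G : ℝ → ℝ} {C : ℝ} {d : ℕ}

/-- The sensitivity of a stored row among the stored rows that did not arrive before it. -/
noncomputable def sampleSens (G : ℝ → ℝ) (S : Memory d) (s : SampledRow d) : ℝ :=
  sSup {y | ∃ x, sampleModular G (S.since s.time) x ≤ 1 ∧ y = G (rowDot s.row x)}

/-- The target weights `γ / (σ + 1 / n)`, where `σ` is the sensitivity estimated from the memory. -/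
noncomputable def sensTarget (G : ℝ → ℝ) (γ : ℝ) (n : ℕ) (S : Memory d) (s : SampledRow d) : ℝ :=
  -- The term `1 / n` keeps the target finite at sensitivity `0` and adds at most `1` to a sum over
  -- `n` rows.
  γ / (sampleSens G S s + 1 / n)

/-- The memory is small and approximates every block of consecutive rows that ends now. -/
def Memory.Accurate (G : ℝ → ℝ) (ε cap : ℝ) (r : ℕ → Fin d → ℤ) (t : ℕ) (S : Memory d) : Prop :=
  (S.card : ℝ) ≤ cap ∧ ∀ i, IsSubspaceEmbedding G ε (S.since i) (rowBlock r i t)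

/-- The invariant of the sampler: stored rows are rows of the stream, and their weights are inversely
proportional to their sensitivities, up to constant factors. -/
structure Memory.Calibrated (G : ℝ → ℝ) (C γ : ℝ) (n : ℕ) (r : ℕ → Fin d → ℤ) (t : ℕ)
    (S : Memory d) : Prop where
  wellFormed : S.WellFormed t
  row_eq : ∀ s ∈ S, s.row = r s.time
  one_le_weight : ∀ s ∈ S, 1 ≤ s.weight
  weight_le : ∀ s ∈ S, s.weight = 1 ∨ ∀ x, blockModular G r s.time t x ≤ 1 →
    s.weight * G (rowDot s.row x) ≤ 4 * C * γ
  -- The weights held at time `t` were set from the memory of time `t - 1`, hence the sensitivity up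
  -- to `t - 1`; the newest row has not been thinned yet.
  le_weight : ∀ s ∈ S, s.time + 1 = t ∨
    γ ≤ s.weight * (4 * C * blockSens G r s.time (t - 1) + 1 / n)

theorem sampleModular_zero (hG : IsOrliczFunction G C) (S : Memory d) :
    sampleModular G S 0 = 0 := by
  simp [sampleModular, rowDot_zero, hG.map_zero]

theorem sampleModular_smul_le (hG : IsOrliczFunction G C) {S : Memory d}
    (hS : ∀ s ∈ S, 0 < s.weight) (x : Fin d → ℝ) {c : ℝ} (h0 : 0 ≤ c) (h1 : c ≤ 1) :
    sampleModular G S (c • x) ≤ c * sampleModular G S x := by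
  have := sampleModular_convex hG hS x 0 h0 (sub_nonneg.2 h1) (by ring)
  simpa [sampleModular_zero hG] using this

theorem sampleSens_nonneg (hG : IsOrliczFunction G C) (S : Memory d) (s : SampledRow d) :
    0 ≤ sampleSens G S s := by
  refine Real.sSup_nonneg ?_
  rintro _ ⟨y, -, rfl⟩
  exact hG.nonneg _

theorem sampleSens_le (hG : IsOrliczFunction G C) (S : Memory d) (s : SampledRow d) {B : ℝ}
    (h : ∀ x, sampleModular G (S.since s.time) x ≤ 1 → G (rowDot s.row x) ≤ B) :
    sampleSens G S s ≤ B := by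
  refine csSup_le ⟨_, 0, by rw [sampleModular_zero hG]; exact zero_le_one, rfl⟩ ?_
  rintro _ ⟨y, hy, rfl⟩
  exact h y hy

theorem le_sampleSens (hG : IsOrliczFunction G C) {S : Memory d} (hw : ∀ s ∈ S, 1 ≤ s.weight)
    {s : SampledRow d} (hs : s ∈ S) {x : Fin d → ℝ}
    (hx : sampleModular G (S.since s.time) x ≤ 1) : G (rowDot s.row x) ≤ sampleSens G S s := by
  refine le_csSup ⟨1, ?_⟩ ⟨x, hx, rfl⟩
  rintro _ ⟨y, hy, rfl⟩
  have h1 : s.weight * G (rowDot s.row y) ≤ sampleModular G (S.since s.time) y :=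
    Finset.single_le_sum (f := fun s : SampledRow d => s.weight * G (rowDot s.row y))
      (fun s' hs' => mul_nonneg (by linarith [hw s' (Memory.mem_since.1 hs').1]) (hG.nonneg _))
      (Memory.mem_since.2 ⟨hs, le_rfl⟩)
  have h2 := mul_le_mul_of_nonneg_right (hw s hs) (hG.nonneg (rowDot s.row y))
  linarith

/-- The price of rescaling a vector by `2` when passing between sample and block; source of the
factors `4 C`. -/
theorem apply_rowDot_le_half (hG : IsOrliczFunction G C) (a : Fin d → ℤ) (x : Fin d → ℝ) :
    G (rowDot a x) ≤ 4 * C * G (rowDot a ((2 : ℝ)⁻¹ • x)) := by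
  have h := hG.mul_le_sq (rowDot a ((2 : ℝ)⁻¹ • x)) (t := 2) (by norm_num)
  rw [rowDot_smul, mul_inv_cancel_left₀ (by norm_num)] at h
  rw [rowDot_smul]
  linarith

theorem IsSubspaceEmbedding.sampleModular_half_le (hG : IsOrliczFunction G C) {S : Memory d}
    (hS : ∀ s ∈ S, 0 < s.weight) {r : ℕ → Fin d → ℤ} {i t : ℕ} {ε : ℝ} (hε : ε ≤ 1 / 2)
    (h : IsSubspaceEmbedding G ε S (rowBlock r i t)) {x : Fin d → ℝ}
    (hx : blockModular G r i t x ≤ 1) : sampleModular G S ((2 : ℝ)⁻¹ • x) ≤ 1 := by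
  rw [← sampleNorm_le_iff hG hS x two_pos]
  have h1 := (blockNorm_le_iff hG r i t x one_pos).2 (by rwa [inv_one, one_smul])
  have h2 := (abs_le.1 (h x)).2
  have h3 := blockNorm_nonneg hG r i t x
  nlinarith

theorem IsSubspaceEmbedding.blockModular_half_le (hG : IsOrliczFunction G C) {S : Memory d}
    (hS : ∀ s ∈ S, 0 < s.weight) {r : ℕ → Fin d → ℤ} {i t : ℕ} {ε : ℝ} (hε : ε ≤ 1 / 2)
    (h : IsSubspaceEmbedding G ε S (rowBlock r i t)) {x : Fin d → ℝ}
    (hx : sampleModular G S x ≤ 1) : blockModular G r i t ((2 : ℝ)⁻¹ • x) ≤ 1 := by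
  rw [← blockNorm_le_iff hG r i t x two_pos]
  have h1 := (sampleNorm_le_iff hG hS x one_pos).2 (by rwa [inv_one, one_smul])
  have h2 := (abs_le.1 (h x)).1
  have h3 := blockNorm_nonneg hG r i t x
  nlinarith

theorem Memory.since_weight_pos {t : ℕ} {S : Memory d} (h : S.WellFormed t) (i : ℕ) :
    ∀ s ∈ S.since i, 0 < s.weight := fun s hs => h.weight_pos s (Memory.mem_since.1 hs).1

/-- An accurate memory changes norms by a factor at most `2`, so halving a feasible vector for the
sample makes it feasible for the block. The converse comparison below is symmetric. -/
theorem Memory.Accurate.sampleSens_le (hG : IsOrliczFunction G C) {ε cap γ : ℝ} {n t : ℕ}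
    {r : ℕ → Fin d → ℤ} {S : Memory d} (hε : ε ≤ 1 / 2) (hI : S.Calibrated G C γ n r t)
    (h : S.Accurate G ε cap r t) {s : SampledRow d} (hs : s ∈ S) :
    sampleSens G S s ≤ 4 * C * blockSens G r s.time t := by
  have hC := hG.one_le_const
  refine _root_.sampleSens_le hG S s fun x hx => ?_
  have h1 := (h.2 s.time).blockModular_half_le hG (Memory.since_weight_pos hI.wellFormed _) hε hx
  have h2 := le_blockSens hG r (hI.wellFormed.time_lt s hs) h1
  rw [← hI.row_eq s hs] at h2
  exact (apply_rowDot_le_half hG s.row x).trans (by gcongr)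

theorem Memory.Accurate.blockSens_le (hG : IsOrliczFunction G C) {ε cap γ : ℝ} {n t : ℕ}
    {r : ℕ → Fin d → ℤ} {S : Memory d} (hε : ε ≤ 1 / 2) (hI : S.Calibrated G C γ n r t)
    (h : S.Accurate G ε cap r t) {s : SampledRow d} (hs : s ∈ S) :
    blockSens G r s.time t ≤ 4 * C * sampleSens G S s := by
  have hC := hG.one_le_const
  refine _root_.blockSens_le hG r fun x hx => ?_
  have h1 := (h.2 s.time).sampleModular_half_le hG (Memory.since_weight_pos hI.wellFormed _) hε hx
  have h2 := le_sampleSens hG hI.one_le_weight hs h1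
  rw [hI.row_eq s hs] at h2
  exact (apply_rowDot_le_half hG _ x).trans (by gcongr)

theorem Memory.Calibrated.empty (G : ℝ → ℝ) (C γ : ℝ) (n : ℕ) (r : ℕ → Fin d → ℤ) :
    (∅ : Memory d).Calibrated G C γ n r 0 := by
  refine ⟨⟨?_, ?_, ?_⟩, ?_, ?_, ?_, ?_⟩ <;> simp

/-- Accuracy makes the estimated sensitivity correct up to `4 C`, so the new target obeys both
weight bounds. A weight that is not raised keeps its upper bound because enlarging the block shrinks
the set of feasible vectors. -/
theorem Memory.Calibrated.nextMemory (hG : IsOrliczFunction G C) {ε cap γ : ℝ} {n t : ℕ}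
    {r : ℕ → Fin d → ℤ} {S T : Memory d} (hγ : 0 < γ) (hn : 0 < n) (hε : ε ≤ 1 / 2)
    (hI : S.Calibrated G C γ n r t) (h : S.Accurate G ε cap r t) (hT : T ⊆ S) :
    (nextMemory (sensTarget G γ n) t (r t) S T).Calibrated G C γ n r (t + 1) := by
  have hC := hG.one_le_const
  have hn' : (0 : ℝ) < 1 / n := by positivity
  refine ⟨hI.wellFormed.nextMemory _ hT _, fun s hs => ?_, fun s hs => ?_, fun s hs => ?_,
    fun s hs => ?_⟩ <;> rcases Finset.mem_insert.1 hs with rfl | hs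
  · rfl
  · obtain ⟨s₀, hs₀, rfl⟩ := Finset.mem_image.1 hs
    exact hI.row_eq s₀ (hT hs₀)
  · exact le_rfl
  · obtain ⟨s₀, hs₀, rfl⟩ := Finset.mem_image.1 hs
    exact one_le_newWeight _ S s₀
  · exact Or.inl rfl
  · obtain ⟨s₀, hs₀, rfl⟩ := Finset.mem_image.1 hs
    have hs₀' := hT hs₀
    have hmono : ∀ x, blockModular G r s₀.time (t + 1) x ≤ 1 → blockModular G r s₀.time t x ≤ 1 :=
      fun x hx => (blockModular_mono hG r le_rfl (Nat.le_succ t) x).trans hx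
    have hσ := sampleSens_nonneg hG S s₀
    simp only [reweight, newWeight]
    rcases max_choice s₀.weight (max 1 (sensTarget G γ n S s₀)) with h1 | h1 <;> rw [h1]
    · rcases hI.weight_le s₀ hs₀' with h2 | h2
      · exact Or.inl h2
      · exact Or.inr fun x hx => h2 x (hmono x hx)
    rcases max_choice 1 (sensTarget G γ n S s₀) with h2 | h2 <;> rw [h2]
    · exact Or.inl rfl
    · refine Or.inr fun x hx => ?_
      have h3 := le_blockSens hG r (hI.wellFormed.time_lt s₀ hs₀') (hmono x hx)
      rw [← hI.row_eq s₀ hs₀'] at h3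
      have h4 := h3.trans (h.blockSens_le hG hε hI hs₀')
      rw [sensTarget, div_mul_eq_mul_div, div_le_iff₀ (by positivity)]
      calc γ * G (rowDot s₀.row x) ≤ γ * (4 * C * sampleSens G S s₀) := by gcongr
        _ = 4 * C * γ * sampleSens G S s₀ := by ring
        _ ≤ 4 * C * γ * (sampleSens G S s₀ + 1 / n) := by gcongr; linarith
  · exact Or.inl rfl
  · obtain ⟨s₀, hs₀, rfl⟩ := Finset.mem_image.1 hs
    have hs₀' := hT hs₀
    have hσ := sampleSens_nonneg hG S s₀
    right
    rw [Nat.add_sub_cancel]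
    have h1 := h.sampleSens_le hG hε hI hs₀'
    have h2 : sensTarget G γ n S s₀ ≤ newWeight (sensTarget G γ n) S s₀ :=
      (le_max_right _ _).trans (le_max_right _ _)
    have h3 : γ = sensTarget G γ n S s₀ * (sampleSens G S s₀ + 1 / n) := by
      rw [sensTarget, div_mul_cancel₀]; positivity
    have h4 : 0 ≤ sensTarget G γ n S s₀ := by rw [sensTarget]; positivity
    calc γ = sensTarget G γ n S s₀ * (sampleSens G S s₀ + 1 / n) := h3
      _ ≤ newWeight (sensTarget G γ n) S s₀ * (4 * C * blockSens G r s₀.time t + 1 / n) := by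
        gcongr
        exact h4.trans h2

/-! ### Exponential moments of the sample -/

section Tails

variable {ε cap γ : ℝ} {n : ℕ} (r : ℕ → Fin d → ℤ)

theorem killedExp_mono_of_calibrated (hG : IsOrliczFunction G C) (hγ : 0 < γ) (hn : 0 < n)
    (hε : ε ≤ 1 / 2) {t : ℕ} {F F' : Memory d → ℝ}
    (h : ∀ S : Memory d, S.Calibrated G C γ n r t → F S ≤ F' S) :
    killedExp (sensTarget G γ n) r (Memory.Accurate G ε cap r) t F ≤
      killedExp (sensTarget G γ n) r (Memory.Accurate G ε cap r) t F' :=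
  killedExp_mono (Inv := Memory.Calibrated G C γ n r) _ _ _ (Memory.Calibrated.empty G C γ n r)
    (fun _ _ hI hA _ hT => hI.nextMemory hG hγ hn hε hA hT) h

theorem killedExp_prodPotential_le_of_calibrated (hG : IsOrliczFunction G C) (hγ : 0 < γ)
    (hn : 0 < n) (hε : ε ≤ 1 / 2) (c : ℕ → ℝ) (t : ℕ)
    (hc : ∀ u ≤ t, ∀ S : Memory d, S.Calibrated G C γ n r u → ∀ s ∈ S,
      0 ≤ 1 + c s.time * s.weight)
    (hc' : ∀ u < t, 0 ≤ 1 + c u) :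
    killedExp (sensTarget G γ n) r (Memory.Accurate G ε cap r) t (prodPotential c) ≤
      ∏ u ∈ Finset.range t, (1 + c u) :=
  killedExp_prodPotential_le _ _ _ (Memory.Calibrated.empty G C γ n r)
    (fun _ _ hI hA _ hT => hI.nextMemory hG hγ hn hε hA hT) (fun _ _ hI => hI.wellFormed) c t hc hc'

/-- Exponential moments of the sampled modular of a fixed vector. -/
theorem killedExp_exp_sampleModular_le (hG : IsOrliczFunction G C) (hγ : 0 < γ) (hn : 0 < n)
    (hε : ε ≤ 1 / 2) {i t : ℕ} {y : Fin d → ℝ} (hy : blockModular G r i t y ≤ 1) {θ : ℝ}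
    (hθ : |θ * (4 * C * γ)| ≤ 1) :
    killedExp (sensTarget G γ n) r (Memory.Accurate G ε cap r) t
        (fun S => Real.exp (θ * sampleModular G (S.since i) y)) ≤
      Real.exp ((θ + θ ^ 2 * (4 * C * γ)) * blockModular G r i t y) := by
  have hC := hG.one_le_const
  set β := 4 * C * γ with hβ
  have hβ0 : 0 < β := by positivity
  -- Rows before `i` get the trivial factor `1`, so the potential sees only the suffix from `i` on.
  set c : ℕ → ℝ := fun u => if i ≤ u then chernoffCoef θ β (G (rowDot (r u) y)) else 0 with hc
  have hfac : ∀ u ≤ t, ∀ S : Memory d, S.Calibrated G C γ n r u → ∀ s ∈ S,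
      (if i ≤ s.time then Real.exp (θ * (s.weight * G (rowDot s.row y))) else 1) ≤
        1 + c s.time * s.weight := by
    intro u hu S hS s hs
    simp only [hc]
    split_ifs with hi
    · rw [hS.row_eq s hs]
      refine exp_le_one_add_chernoffCoef_mul θ hβ0 (hG.nonneg _) (hS.one_le_weight s hs) ?_
      refine (hS.weight_le s hs).imp_right fun h => ?_
      have := h y ((blockModular_mono hG r hi hu y).trans hy)
      rwa [hS.row_eq s hs] at this
    · simp
  have hprod := killedExp_prodPotential_le_of_calibrated (ε := ε) (cap := cap) r hG hγ hn hε c t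
    (fun u hu S hS s hs => le_trans (by split_ifs <;> positivity) (hfac u hu S hS s hs))
    (fun u hu => by
      simp only [hc]
      split_ifs with hi
      · have := exp_le_one_add_chernoffCoef_mul θ hβ0 (hG.nonneg (rowDot (r u) y)) le_rfl (Or.inl rfl)
        rw [mul_one] at this
        exact (Real.exp_pos _).le.trans this
      · simp)
  refine (killedExp_mono_of_calibrated r hG hγ hn hε fun S hS => ?_).trans (hprod.trans ?_)
  · rw [sampleModular, Memory.since, Finset.mul_sum, Real.exp_sum, Finset.prod_filter]
    refine Finset.prod_le_prod (fun s _ => by split_ifs <;> positivity) fun s hs => ?_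
    exact hfac t le_rfl S hS s hs
  · have h1 : ∀ u ∈ Finset.range t, 1 + c u ≤
        Real.exp (if i ≤ u then (θ + θ ^ 2 * β) * G (rowDot (r u) y) else 0) := by
      intro u _
      simp only [hc]
      split_ifs
      · exact one_add_chernoffCoef_le θ hβ0 (hG.nonneg _) hθ
      · simp
    refine (Finset.prod_le_prod (fun u hu => ?_) h1).trans_eq ?_
    · simp only [hc]
      split_ifs
      · have := exp_le_one_add_chernoffCoef_mul θ hβ0 (hG.nonneg (rowDot (r u) y)) le_rfl (Or.inl rfl)
        rw [mul_one] at this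
        exact (Real.exp_pos _).le.trans this
      · simp
    · rw [← Real.exp_sum, ← Finset.sum_filter, blockModular, Finset.mul_sum]
      congr 2
      ext u
      simp only [Finset.mem_filter, Finset.mem_range, Finset.mem_Ico]
      tauto

/-- Exponential moment of the number of stored rows. -/
theorem killedExp_exp_card_le (hG : IsOrliczFunction G C) (hγ : 0 < γ) (hn : 0 < n)
    (hε : ε ≤ 1 / 2) {t : ℕ} (ht : t ≤ n) {B : ℝ} (hB0 : 0 ≤ B)
    (hB : ∑ u ∈ Finset.range (t - 1), blockSens G r u (t - 1) ≤ B) :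
    killedExp (sensTarget G γ n) r (Memory.Accurate G ε cap r) t
        (fun S => Real.exp S.card) ≤
      Real.exp (2 * (1 + (4 * C * B + 1) / γ)) := by
  have hC := hG.one_le_const
  -- A deterministic bound for the inverse weight of row `u`. Since `w π ≥ 1` and `e < 3`, each
  -- stored row satisfies `e ≤ 1 + 2 π w`.
  set π : ℕ → ℝ := fun u =>
    if u + 1 = t then 1 else (4 * C * blockSens G r u (t - 1) + 1 / n) / γ with hπ
  have hπ0 : ∀ u, 0 ≤ π u := fun u => by
    have := blockSens_nonneg hG r u (t - 1)
    simp only [hπ]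
    split_ifs <;> positivity
  have hprod := killedExp_prodPotential_le_of_calibrated (ε := ε) (cap := cap) r hG hγ hn hε
    (fun u => 2 * π u) t (fun u hu S hS s hs => by
      have h1 := hS.one_le_weight s hs
      have h2 := hπ0 s.time
      positivity) (fun u hu => by have := hπ0 u; positivity)
  refine (killedExp_mono_of_calibrated r hG hγ hn hε fun S hS => ?_).trans (hprod.trans ?_)
  · rw [← mul_one (S.card : ℝ), Real.exp_nat_mul, prodPotential, ← Finset.prod_const]
    refine Finset.prod_le_prod (fun _ _ => (Real.exp_pos _).le) fun s hs => ?_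
    have h1 : 1 ≤ s.weight * π s.time := by
      simp only [hπ]
      split_ifs with hst
      · rw [mul_one]; exact hS.one_le_weight s hs
      · rw [← mul_div_assoc, one_le_div hγ]
        exact (hS.le_weight s hs).resolve_left hst
    have h2 := Real.exp_one_lt_d9
    nlinarith
  · have h1 : ∀ u ∈ Finset.range t, 1 + 2 * π u ≤ Real.exp (2 * π u) := fun u _ => by
      linarith [Real.add_one_le_exp (2 * π u)]
    refine (Finset.prod_le_prod (fun u _ => by have := hπ0 u; positivity) h1).trans ?_
    rw [← Real.exp_sum, ← Finset.mul_sum]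
    refine Real.exp_le_exp.2 (mul_le_mul_of_nonneg_left ?_ two_pos.le)
    rcases Nat.eq_zero_or_pos t with rfl | ht0
    · simp only [Finset.range_zero, Finset.sum_empty]; positivity
    obtain ⟨v, rfl⟩ : ∃ v, t = v + 1 := ⟨t - 1, by omega⟩
    rw [Nat.add_sub_cancel] at hB
    rw [Finset.sum_range_succ, add_comm]
    refine add_le_add (by simp [hπ]) ?_
    have h2 : ∀ u ∈ Finset.range v, π u = (4 * C * blockSens G r u v + 1 / n) / γ := fun u hu => by
      have := Finset.mem_range.1 hu
      simp only [hπ, Nat.add_sub_cancel]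
      rw [if_neg (by omega)]
    rw [Finset.sum_congr rfl h2, ← Finset.sum_div, Finset.sum_add_distrib, ← Finset.mul_sum,
      Finset.sum_const, Finset.card_range, nsmul_eq_mul]
    have hv : (v : ℝ) * (1 / n) ≤ 1 := by
      rw [mul_one_div, div_le_one (by positivity)]
      exact_mod_cast (by omega : v ≤ n)
    gcongr

end Tails

end Sampler

/-! ### From accuracy on a net to a subspace embedding -/

section Embedding

variable {G : ℝ → ℝ} {C : ℝ} {d : ℕ}

theorem blockModular_eq_one (hG : IsOrliczFunction G C) (r : ℕ → Fin d → ℤ) {i t : ℕ}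
    {y : Fin d → ℝ} (hy : orliczNorm G (rowBlock r i t *ᵥ y) = 1) :
    blockModular G r i t y = 1 := by
  rw [orliczNorm_eq_weighted] at hy
  have hne : rowBlock r i t *ᵥ y ≠ 0 := by
    intro h0
    rw [h0, hG.weightedOrliczNorm_zero] at hy
    exact zero_ne_one hy
  have h := (hG.exists_weightedOrliczNorm (fun _ => one_pos) hne).2
  rw [hy] at h
  simp only [one_mul, div_one, hG.apply_abs] at h
  rw [blockModular, ← Finset.sum_coe_sort]
  exact h

/-- Convexity makes the modular at least linear along rays beyond norm `1` and at most linear below,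
so its deviation from `1` bounds that of the norm. -/
theorem abs_sampleNorm_sub_one_le (hG : IsOrliczFunction G C) {S : Memory d}
    (hS : ∀ s ∈ S, 0 < s.weight) {y : Fin d → ℝ} {η : ℝ} (hη0 : 0 < η) (hη1 : η < 1)
    (h : |sampleModular G S y - 1| ≤ η) : |sampleNorm G S y - 1| ≤ η := by
  obtain ⟨hlow, hup⟩ := abs_le.1 h
  rw [abs_le]
  constructor
  · by_contra hcon
    rw [not_le] at hcon
    -- The maximum keeps the scaling factor positive even if the sample norm vanishes.
    set c := max (sampleNorm G S y) ((1 - η) / 2) with hc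
    have hc0 : 0 < c := lt_of_lt_of_le (by linarith) (le_max_right _ _)
    have hc1 : c < 1 - η := max_lt (by linarith) (by linarith)
    have h1 := (sampleNorm_le_iff hG hS y hc0).1 (le_max_left _ _)
    have h2 := sampleModular_smul_le hG hS (c⁻¹ • y) hc0.le (by linarith)
    rw [smul_inv_smul₀ hc0.ne'] at h2
    nlinarith
  · rw [sub_le_iff_le_add, sampleNorm_le_iff hG hS y (by linarith)]
    have h0 : 0 < η + 1 := by linarith
    refine (sampleModular_smul_le hG hS y (by positivity)
      (inv_le_one_of_one_le₀ (by linarith))).trans ?_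
    rw [inv_mul_le_iff₀ h0]
    linarith

/-- A crude bound whose size is irrelevant: it only ensures that the best comparison constant in
`seminorm_compare_of_net` is finite. -/
theorem sampleNorm_le_mul_blockNorm (hG : IsOrliczFunction G C) {r : ℕ → Fin d → ℤ} {i t : ℕ}
    {S : Memory d} (hS : ∀ s ∈ S, 0 < s.weight) (hrow : ∀ s ∈ S, s.row = r s.time)
    (htime : ∀ s ∈ S, i ≤ s.time ∧ s.time < t) (x : Fin d → ℝ) :
    sampleNorm G S x ≤ (1 + ∑ s ∈ S, s.weight) * orliczNorm G (rowBlock r i t *ᵥ x) := by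
  have hw : 0 ≤ ∑ s ∈ S, s.weight := Finset.sum_nonneg fun s hs => (hS s hs).le
  set B := 1 + ∑ s ∈ S, s.weight with hB
  have hB1 : 1 ≤ B := by linarith
  refine le_of_forall_pos_le_add fun e he => ?_
  have hp := blockNorm_nonneg hG r i t x
  set a := orliczNorm G (rowBlock r i t *ᵥ x) + e / B with ha
  have ha0 : 0 < a := by positivity
  rw [show B * orliczNorm G (rowBlock r i t *ᵥ x) + e = B * a by rw [ha]; field_simp,
    sampleNorm_le_iff hG hS x (by positivity), mul_inv, mul_smul]
  have h1 := (blockNorm_le_iff hG r i t x ha0).1 (by rw [ha]; linarith [div_pos he (by linarith : 0 < B)])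
  refine (sampleModular_smul_le hG hS _ (by positivity) (inv_le_one_of_one_le₀ hB1)).trans ?_
  rw [inv_mul_le_iff₀ (by linarith), mul_one]
  refine le_trans ?_ (by linarith : ∑ s ∈ S, s.weight ≤ B)
  refine Finset.sum_le_sum fun s hs => ?_
  have h2 := (apply_rowDot_le_blockModular hG r (htime s hs).1 (htime s hs).2 (a⁻¹ • x)).trans h1
  rw [hrow s hs]
  exact mul_le_of_le_one_right (hS s hs).le h2

/-- A sample whose modular is accurate on a net of the unit sphere is a subspace embedding. -/
theorem isSubspaceEmbedding_of_net (hG : IsOrliczFunction G C) {r : ℕ → Fin d → ℤ} {i t : ℕ}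
    {S : Memory d} (hS : ∀ s ∈ S, 0 < s.weight) (hrow : ∀ s ∈ S, s.row = r s.time)
    (htime : ∀ s ∈ S, i ≤ s.time ∧ s.time < t) {ε : ℝ} (hε0 : 0 < ε) (hε1 : ε ≤ 1 / 2)
    (N : Finset (Fin d → ℝ))
    (hcover : ∀ z, orliczNorm G (rowBlock r i t *ᵥ z) = 1 →
      ∃ y ∈ N, orliczNorm G (rowBlock r i t *ᵥ (z - y)) ≤ ε / 4)
    (h : ∀ y ∈ N, |sampleModular G S y - 1| ≤ ε / 4) :
    IsSubspaceEmbedding G ε S (rowBlock r i t) := by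
  obtain ⟨p, hp⟩ := exists_seminorm_blockNorm hG r i t
  obtain ⟨q, hq⟩ := exists_seminorm_sampleNorm hG hS
  intro x
  obtain ⟨h1, h2⟩ := seminorm_compare_of_net p q N (η := ε / 4) (by linarith) (by linarith)
    (fun z hz => by
      obtain ⟨y, hy, hzy⟩ := hcover z (by rw [← hp, hz])
      exact ⟨y, hy, by rwa [hp]⟩)
    (fun y hy => by
      rw [hq]
      exact abs_sampleNorm_sub_one_le hG hS (by linarith) (by linarith) (h y hy))
    ⟨_, fun x => by
      rw [hp, hq]
      exact sampleNorm_le_mul_blockNorm hG hS hrow htime x⟩ x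
  rw [hp, hq] at h1 h2
  have hpx := blockNorm_nonneg hG r i t x
  have hu : (1 + ε / 4) / (1 - ε / 4) ≤ 1 + ε := by
    rw [div_le_iff₀ (by linarith)]; nlinarith
  have hl : 1 - ε ≤ 1 - ε / 4 - ε / 4 * ((1 + ε / 4) / (1 - ε / 4)) := by nlinarith
  rw [abs_le]
  constructor
  · nlinarith [mul_le_mul_of_nonneg_right hl hpx]
  · nlinarith [mul_le_mul_of_nonneg_right hu hpx]

theorem isSubspaceEmbedding_empty (G : ℝ → ℝ) (ε : ℝ) (r : ℕ → Fin d → ℤ) {i t : ℕ}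
    (hit : t ≤ i) : IsSubspaceEmbedding G ε (∅ : Memory d) (rowBlock r i t) := by
  intro x
  have h1 : sampleNorm G (∅ : Memory d) x = 0 := by
    simp [sampleNorm, weightedOrliczNorm]
  have h2 : orliczNorm G (rowBlock r i t *ᵥ x) = 0 := by
    have : IsEmpty (Finset.Ico i t) := by
      rw [Finset.Ico_eq_empty (not_lt.2 hit)]; infer_instance
    simp [orliczNorm]
  rw [h1, h2]
  simp

end Embedding

/-! ### Probability of a first failure -/

section Failure

variable {G : ℝ → ℝ} {C : ℝ} {d : ℕ} {ε cap γ : ℝ} {n : ℕ}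

/-- The two exponential moments that dominate the indicator of a deviation of the modular at `y`. -/
noncomputable def deviationMoment (G : ℝ → ℝ) (lam η : ℝ) (i : ℕ) (y : Fin d → ℝ)
    (S : Memory d) : ℝ :=
  Real.exp (-(lam * (1 + η))) * Real.exp (lam * sampleModular G (S.since i) y) +
    Real.exp (lam * (1 - η)) * Real.exp (-lam * sampleModular G (S.since i) y)

theorem deviationMoment_nonneg (G : ℝ → ℝ) (lam η : ℝ) (i : ℕ) (y : Fin d → ℝ) (S : Memory d) :
    0 ≤ deviationMoment G lam η i y S := by
  unfold deviationMoment; positivity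

theorem one_le_deviationMoment (G : ℝ → ℝ) (S : Memory d) (i : ℕ) (y : Fin d → ℝ) {η lam : ℝ}
    (hlam : 0 ≤ lam) (h : ¬ |sampleModular G (S.since i) y - 1| ≤ η) :
    1 ≤ deviationMoment G lam η i y S := by
  rw [deviationMoment, ← Real.exp_add, ← Real.exp_add]
  set M := sampleModular G (S.since i) y
  rcases lt_abs.1 (not_le.1 h) with h | h
  · have h1 : 1 ≤ Real.exp (-(lam * (1 + η)) + lam * M) := Real.one_le_exp (by nlinarith)
    linarith [Real.exp_pos (lam * (1 - η) + -lam * M)]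
  · have h1 : 1 ≤ Real.exp (lam * (1 - η) + -lam * M) := Real.one_le_exp (by nlinarith)
    linarith [Real.exp_pos (-(lam * (1 + η)) + lam * M)]

/-- The choice `lam = η / (2β)` with `β = 4 C γ` minimises the exponent `-lam η + lam² β`, with
value `-η² / (4β)`. -/
theorem killedExp_deviationMoment_le (r : ℕ → Fin d → ℤ) (hG : IsOrliczFunction G C) (hγ : 0 < γ)
    (hn : 0 < n) (hε : ε ≤ 1 / 2) {i t : ℕ} {y : Fin d → ℝ} (hy : blockModular G r i t y = 1)
    {η : ℝ} (hη0 : 0 < η) (hη1 : η ≤ 1) :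
    killedExp (sensTarget G γ n) r (Memory.Accurate G ε cap r) t
        (deviationMoment G (η / (2 * (4 * C * γ))) η i y) ≤
      2 * Real.exp (-η ^ 2 / (4 * (4 * C * γ))) := by
  have hC := hG.one_le_const
  set β := 4 * C * γ with hβ
  have hβ0 : 0 < β := by positivity
  set lam := η / (2 * β) with hlam
  have hlamβ : lam * β = η / 2 := by rw [hlam]; field_simp
  have hexp : -lam * η + lam ^ 2 * β = -η ^ 2 / (4 * β) := by rw [hlam]; field_simp; ring
  have hu := killedExp_exp_sampleModular_le (ε := ε) (cap := cap) r hG hγ hn hε hy.le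
    (θ := lam) (by rw [← hβ, hlamβ, abs_of_pos] <;> linarith)
  have hl := killedExp_exp_sampleModular_le (ε := ε) (cap := cap) r hG hγ hn hε hy.le
    (θ := -lam) (by rw [← hβ, neg_mul, abs_neg, hlamβ, abs_of_pos] <;> linarith)
  rw [hy, mul_one, ← hβ] at hu hl
  unfold deviationMoment
  rw [killedExp_add, killedExp_mul, killedExp_mul, two_mul]
  refine add_le_add ?_ ?_
  · refine (mul_le_mul_of_nonneg_left hu (Real.exp_pos _).le).trans_eq ?_
    rw [← Real.exp_add, ← hexp]
    congr 1; ring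
  · refine (mul_le_mul_of_nonneg_left hl (Real.exp_pos _).le).trans_eq ?_
    rw [← Real.exp_add, ← hexp]
    congr 1; ring

/-- If the memory is not accurate, it is too large or deviates at a point of one of the nets. -/
theorem one_le_of_not_accurate (r : ℕ → Fin d → ℤ) (hG : IsOrliczFunction G C) {t : ℕ}
    {S : Memory d} (hS : S.Calibrated G C γ n r t) (hε0 : 0 < ε) (hε : ε ≤ 1 / 2)
    (N : ℕ → Finset (Fin d → ℝ))
    (hN : ∀ i z, orliczNorm G (rowBlock r i t *ᵥ z) = 1 →
      ∃ y ∈ N i, orliczNorm G (rowBlock r i t *ᵥ (z - y)) ≤ ε / 4)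
    {lam : ℝ} (hlam : 0 ≤ lam) (h : ¬ S.Accurate G ε cap r t) :
    1 ≤ ∑ i ∈ Finset.range t, ∑ y ∈ N i, deviationMoment G lam (ε / 4) i y S +
      Real.exp (-cap) * Real.exp S.card := by
  have hsum : 0 ≤ ∑ i ∈ Finset.range t, ∑ y ∈ N i, deviationMoment G lam (ε / 4) i y S :=
    Finset.sum_nonneg fun i _ => Finset.sum_nonneg fun y _ => deviationMoment_nonneg _ _ _ _ _ _
  rw [Memory.Accurate, not_and_or] at h
  rcases h with hcard | hemb
  · have h1 : 1 ≤ Real.exp (-cap) * Real.exp S.card := by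
      rw [← Real.exp_add]
      exact Real.one_le_exp (by linarith [not_le.1 hcard])
    linarith
  · obtain ⟨i, hi⟩ := not_forall.1 hemb
    -- For `i ≥ t` both the sample and the block are empty, so only `t` suffixes enter the union
    -- bound.
    have hit : i < t := by
      by_contra hti
      refine hi ?_
      have : S.since i = ∅ := Finset.filter_eq_empty_iff.2 fun s hs => by
        have := hS.wellFormed.time_lt s hs
        omega
      rw [this]
      exact isSubspaceEmbedding_empty G ε r (not_lt.1 hti)
    obtain ⟨y, hyN, hy⟩ : ∃ y ∈ N i, ¬ |sampleModular G (S.since i) y - 1| ≤ ε / 4 := by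
      by_contra! hcon
      exact hi (isSubspaceEmbedding_of_net hG (Memory.since_weight_pos hS.wellFormed i)
        (fun s hs => hS.row_eq s (Memory.mem_since.1 hs).1)
        (fun s hs => ⟨(Memory.mem_since.1 hs).2,
          hS.wellFormed.time_lt s (Memory.mem_since.1 hs).1⟩) hε0 hε (N i) (hN i) hcon)
    have h1 := one_le_deviationMoment G S i y hlam hy
    have h2 := Finset.single_le_sum (f := fun y => deviationMoment G lam (ε / 4) i y S)
      (fun y _ => deviationMoment_nonneg _ _ _ _ _ _) hyN
    have h3 := Finset.single_le_sum
      (f := fun i => ∑ y ∈ N i, deviationMoment G lam (ε / 4) i y S)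
      (fun i _ => Finset.sum_nonneg fun y _ => deviationMoment_nonneg _ _ _ _ _ _)
      (Finset.mem_range.2 hit)
    exact (h1.trans (h2.trans h3)).trans (le_add_of_nonneg_right (by positivity))

open Classical in
/-- The probability that the memory stops being accurate at a given time. -/
theorem killedExp_not_accurate_le (r : ℕ → Fin d → ℤ) (hG : IsOrliczFunction G C) (hγ : 0 < γ)
    (hn : 0 < n) (hε0 : 0 < ε) (hε : ε ≤ 1 / 2) {t : ℕ} (ht : t ≤ n) {B : ℝ} (hB0 : 0 ≤ B)
    (hB : ∑ u ∈ Finset.range (t - 1), blockSens G r u (t - 1) ≤ B) :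
    killedExp (sensTarget G γ n) r (Memory.Accurate G ε cap r) t
        (fun S => if S.Accurate G ε cap r t then 0 else 1) ≤
      n * (1 + 8 / ε) ^ d * (2 * Real.exp (-(ε / 4) ^ 2 / (4 * (4 * C * γ)))) +
        Real.exp (2 * (1 + (4 * C * B + 1) / γ) - cap) := by
  have hC := hG.one_le_const
  have hnet : ∀ i, ∃ N : Finset (Fin d → ℝ),
      (∀ y ∈ N, orliczNorm G (rowBlock r i t *ᵥ y) = 1) ∧ (N.card : ℝ) ≤ (1 + 8 / ε) ^ d ∧
      ∀ z, orliczNorm G (rowBlock r i t *ᵥ z) = 1 →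
        ∃ y ∈ N, orliczNorm G (rowBlock r i t *ᵥ (z - y)) ≤ ε / 4 := by
    intro i
    obtain ⟨p, hp⟩ := exists_seminorm_blockNorm hG r i t
    obtain ⟨N, h1, h2, h3⟩ := p.exists_net (η := ε / 4) (by linarith)
    simp only [hp] at h1 h3
    refine ⟨N, h1, h2.trans_eq ?_, h3⟩
    rw [Module.finrank_fin_fun, show 2 / (ε / 4) = 8 / ε by field_simp; norm_num]
  choose N hN1 hN2 hN3 using hnet
  set lam := ε / 4 / (2 * (4 * C * γ)) with hlam
  have hlam0 : 0 ≤ lam := by positivity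
  refine (killedExp_mono_of_calibrated r hG hγ hn hε (F' := fun S =>
    (∑ i ∈ Finset.range t, ∑ y ∈ N i, deviationMoment G lam (ε / 4) i y S) +
      Real.exp (-cap) * Real.exp S.card) fun S hS => ?_).trans ?_
  · split_ifs with hacc
    · exact add_nonneg (Finset.sum_nonneg fun i _ => Finset.sum_nonneg fun y _ =>
        deviationMoment_nonneg _ _ _ _ _ _) (by positivity)
    · exact one_le_of_not_accurate r hG hS hε0 hε N hN3 hlam0 hacc
  rw [killedExp_add, killedExp_sum, killedExp_mul]
  refine add_le_add ?_ ?_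
  · have hi : ∀ i ∈ Finset.range t,
        killedExp (sensTarget G γ n) r (Memory.Accurate G ε cap r) t
          (fun S => ∑ y ∈ N i, deviationMoment G lam (ε / 4) i y S) ≤
        (1 + 8 / ε) ^ d * (2 * Real.exp (-(ε / 4) ^ 2 / (4 * (4 * C * γ)))) := by
      intro i _
      rw [killedExp_sum]
      refine (Finset.sum_le_card_nsmul _ _ _ fun y hy => killedExp_deviationMoment_le r hG hγ hn hε
        (blockModular_eq_one hG r (hN1 i y hy)) (by linarith) (by linarith)).trans ?_
      rw [nsmul_eq_mul]
      have := hN2 i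
      gcongr
    refine (Finset.sum_le_card_nsmul _ _ _ hi).trans ?_
    rw [nsmul_eq_mul, Finset.card_range, ← mul_assoc]
    have : (t : ℝ) ≤ n := by exact_mod_cast ht
    gcongr
  · refine (mul_le_mul_of_nonneg_left
      (killedExp_exp_card_le r hG hγ hn hε ht hB0 hB) (Real.exp_pos _).le).trans_eq ?_
    rw [← Real.exp_add]
    congr 1; ring

end Failure

/-! ### Reduction to probabilities and the trivial samplers -/

section Algorithms

variable {G : ℝ → ℝ} {C : ℝ} {d : ℕ}

/-- Markov's inequality for a function that is at least `1` off the event. -/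
theorem PMF.ofReal_one_sub_le_toOuterMeasure {α : Type*} (p : PMF α) (E : Set α)
    (f : α → ENNReal) (hf : ∀ a ∉ E, 1 ≤ f a) {δ : ℝ} (hδ : 0 ≤ δ)
    (h : ∑' a, p a * f a ≤ ENNReal.ofReal δ) :
    ENNReal.ofReal (1 - δ) ≤ p.toOuterMeasure E := by
  rw [ENNReal.ofReal_sub _ hδ, ENNReal.ofReal_one, tsub_le_iff_right, PMF.toOuterMeasure_apply]
  refine le_trans ?_ (add_le_add le_rfl h)
  rw [← p.tsum_coe, ← ENNReal.tsum_add]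
  refine ENNReal.tsum_le_tsum fun a => ?_
  by_cases ha : a ∈ E
  · rw [Set.indicator_of_mem ha]; exact le_self_add
  · rw [Set.indicator_of_notMem ha, zero_add]
    exact le_mul_of_one_le_right zero_le (hf a ha)

theorem output_eq_since (W m : ℕ) (S : Memory d) : output W m S = S.since (m - W) :=
  Finset.filter_congr fun s _ => by omega

/-- The sampler that stores nothing. -/
noncomputable def emptySampler (d : ℕ) : RowSampler d where
  step _ _ _ := PMF.pure ∅
  step_spec := by
    intro t S a S' hS' s hs
    rw [PMF.support_pure, Set.mem_singleton_iff] at hS'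
    rw [hS'] at hs
    exact absurd hs (Finset.notMem_empty s)

theorem emptySampler_run (r : ℕ → Fin d → ℤ) (m : ℕ) :
    (emptySampler d).run r m = PMF.pure (∅, 0) := by
  induction m with
  | zero => rfl
  | succ m ih => rw [RowSampler.run, ih, PMF.pure_bind, emptySampler, PMF.pure_map]; simp

theorem PMF.toOuterMeasure_pure_of_mem {α : Type*} {a : α} {E : Set α} (h : a ∈ E) :
    (PMF.pure a).toOuterMeasure E = 1 := by
  classical
  rw [PMF.toOuterMeasure_pure_apply, if_pos h]

theorem sampleNorm_empty (G : ℝ → ℝ) (x : Fin d → ℝ) : sampleNorm G (∅ : Memory d) x = 0 := by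
  simp [sampleNorm, weightedOrliczNorm]

/-- The sampler that stores every row with weight `1`. -/
noncomputable def storeAllSampler (d : ℕ) : RowSampler d where
  step t S a := PMF.pure (insert ⟨t, a, 1⟩ (S.filter fun s => 0 < s.weight))
  step_spec := by
    intro t S a S' hS' s hs
    rw [PMF.support_pure, Set.mem_singleton_iff] at hS'
    rw [hS'] at hs
    rcases Finset.mem_insert.1 hs with rfl | hs
    · exact ⟨one_pos, Or.inl ⟨rfl, rfl⟩⟩
    · obtain ⟨h1, h2⟩ := Finset.mem_filter.1 hs
      exact ⟨h2, Or.inr ⟨s, h1, rfl, rfl⟩⟩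

/-- All the rows `r 0, …, r (m - 1)`, with weight `1`. -/
noncomputable def fullMemory (r : ℕ → Fin d → ℤ) (m : ℕ) : Memory d :=
  (Finset.range m).image fun i => ⟨i, r i, 1⟩

theorem fullMemory_injective (r : ℕ → Fin d → ℤ) :
    Function.Injective fun i => (⟨i, r i, 1⟩ : SampledRow d) := fun _ _ h =>
  congrArg SampledRow.time h

theorem fullMemory_weight (r : ℕ → Fin d → ℤ) (m : ℕ) : ∀ s ∈ fullMemory r m, s.weight = 1 := by
  intro s hs
  obtain ⟨i, -, rfl⟩ := Finset.mem_image.1 hs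
  rfl

theorem card_fullMemory (r : ℕ → Fin d → ℤ) (m : ℕ) : (fullMemory r m).card = m := by
  rw [fullMemory, Finset.card_image_of_injective _ (fullMemory_injective r), Finset.card_range]

theorem storeAllSampler_run (r : ℕ → Fin d → ℤ) (m : ℕ) :
    (storeAllSampler d).run r m = PMF.pure (fullMemory r m, m) := by
  induction m with
  | zero => rfl
  | succ m ih =>
    have h : insert ⟨m, r m, 1⟩ ((fullMemory r m).filter fun s => 0 < s.weight) =
        fullMemory r (m + 1) := by
      rw [Finset.filter_true_of_mem fun s hs => by rw [fullMemory_weight r m s hs]; exact one_pos,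
        fullMemory, fullMemory, Finset.range_add_one, Finset.image_insert]
    rw [RowSampler.run, ih, PMF.pure_bind, storeAllSampler, PMF.pure_map]
    simp only
    rw [h, card_fullMemory, max_eq_right (Nat.le_succ m)]

theorem sampleNorm_fullMemory (hG : IsOrliczFunction G C) (r : ℕ → Fin d → ℤ) (i m : ℕ)
    (x : Fin d → ℝ) :
    sampleNorm G ((fullMemory r m).since i) x = orliczNorm G (rowBlock r i m *ᵥ x) := by
  have hw : ∀ s ∈ (fullMemory r m).since i, 0 < s.weight := fun s hs => by
    rw [fullMemory_weight r m s (Memory.mem_since.1 hs).1]; exact one_pos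
  have hmod : ∀ x, sampleModular G ((fullMemory r m).since i) x = blockModular G r i m x := by
    intro x
    rw [sampleModular, Memory.since, fullMemory, Finset.filter_image,
      Finset.sum_image fun _ _ _ _ h => fullMemory_injective r h, blockModular]
    simp only [one_mul]
    refine Finset.sum_congr ?_ fun _ _ => rfl
    ext u
    simp only [Finset.mem_filter, Finset.mem_range, Finset.mem_Ico]
    tauto
  have hiff : ∀ c : ℝ, 0 < c → (sampleNorm G ((fullMemory r m).since i) x ≤ c ↔
      orliczNorm G (rowBlock r i m *ᵥ x) ≤ c) := fun c hc => by
    rw [sampleNorm_le_iff hG hw x hc, blockNorm_le_iff hG r i m x hc, hmod]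
  have h1 := sampleNorm_nonneg hG hw x
  have h2 := blockNorm_nonneg hG r i m x
  refine le_antisymm (le_of_forall_pos_le_add fun e he => ?_)
    (le_of_forall_pos_le_add fun e he => ?_)
  · exact (hiff _ (by linarith)).2 (by linarith)
  · exact (hiff _ (by linarith)).1 (by linarith)

end Algorithms

/-! ### Choice of constants and conclusion -/

theorem failure_bound {n d c : ℕ} {ε : ℝ} (hn : 4 ≤ n) (hd : 1 ≤ d) (hε0 : 0 < ε)
    (hεn : 1 / ε ≤ n) :
    ((n : ℝ) + 1) * (n * (1 + 8 / ε) ^ d * (2 * Real.exp (-((c + 10) * d * Real.log n))) +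
      Real.exp (-((c + 10) * d * Real.log n))) ≤ 1 / (n : ℝ) ^ c := by
  have hn4 : (4 : ℝ) ≤ n := by exact_mod_cast hn
  have hn0 : (0 : ℝ) < n := by linarith
  have hn1 : (1 : ℝ) ≤ n := by linarith
  have hexp : Real.exp (-((c + 10) * d * Real.log n)) = 1 / (n : ℝ) ^ ((c + 10) * d) := by
    rw [Real.exp_neg, one_div, ← Real.exp_log (pow_pos hn0 _), Real.log_pow]
    push_cast
    rfl
  rw [hexp]
  -- For `n ≥ 4` one has `1 + 8 n ≤ n³`. All union bounds together then cost `n^(4 + 3d)`, which `(c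
  -- + 10) d` in the exponent absorbs, leaving `n^(-c)`.
  have hN : (1 + 8 / ε) ^ d ≤ (n : ℝ) ^ (3 * d) := by
    rw [pow_mul]
    refine pow_le_pow_left₀ (by positivity) ?_ d
    have h1 : 8 / ε = 8 * (1 / ε) := by ring
    rw [h1]
    nlinarith [mul_le_mul hn4 hn4 (by norm_num) hn0.le]
  have hsum : ((n : ℝ) + 1) * (n * (1 + 8 / ε) ^ d * 2 + 1) ≤ (n : ℝ) ^ (4 + 3 * d) := by
    have h1 : (n : ℝ) + 1 ≤ (n : ℝ) ^ 2 := by nlinarith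
    have h2 : (1 : ℝ) ≤ (n : ℝ) ^ (3 * d) := one_le_pow₀ hn1
    have h3 : (n : ℝ) * (1 + 8 / ε) ^ d * 2 + 1 ≤ (n : ℝ) ^ 2 * (n : ℝ) ^ (3 * d) := by
      have h6 : (n : ℝ) * 2 + 1 ≤ (n : ℝ) ^ 2 := by nlinarith
      have h4 : (n : ℝ) * (1 + 8 / ε) ^ d * 2 ≤ n * (n : ℝ) ^ (3 * d) * 2 := by gcongr
      have h5 := mul_le_mul_of_nonneg_right h6 (zero_le_one.trans h2)
      linarith
    calc _ ≤ (n : ℝ) ^ 2 * ((n : ℝ) ^ 2 * (n : ℝ) ^ (3 * d)) := by gcongr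
      _ = _ := by ring
  calc _ = ((n : ℝ) + 1) * (n * (1 + 8 / ε) ^ d * 2 + 1) * (1 / (n : ℝ) ^ ((c + 10) * d)) := by ring
    _ ≤ (n : ℝ) ^ (4 + 3 * d) * (1 / (n : ℝ) ^ ((c + 10) * d)) := by gcongr
    _ ≤ 1 / (n : ℝ) ^ c := by
      rw [mul_one_div, div_le_div_iff₀ (by positivity) (by positivity), ← pow_add, one_mul]
      refine pow_le_pow_right₀ hn1 ?_
      nlinarith

/-- The constant in the memory bound of the sampler. -/
noncomputable def capConst (C : ℝ) (b c : ℕ) : ℝ :=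
  4 * (32 + 512 * (4 * C * (8 + 9 * (4 * b + 20) / Real.log (1 + 1 / (2 * C))) + 8) * C * (c + 10) +
    8 * (c + 10))

/-- Here `D`, `x`, `k` stand for `d`, `log n`, `log κ`. The cap is of order `D² x³ k / ε²`; as `x`
and `k` are at least `1/2`, lower-order terms and the passage to `x⁵` cost constants only. -/
theorem cap_bound {C : ℝ} (hC : 1 ≤ C) (b c : ℕ) {D x k ε : ℝ} (hD : 1 ≤ D) (hx : 1 / 2 ≤ x)
    (hk : 1 / 2 ≤ k) (hε0 : 0 < ε) (hε1 : ε ≤ 1) :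
    2 * (1 + (4 * C * (1 + 3 * x * (3 * (D * ((2 * b + 8) * x + 2 * k) /
      Real.log (1 + 1 / (2 * C))))) + 1) / (ε ^ 2 / (256 * C * ((c + 10) * D * x)))) +
      (c + 10) * D * x ≤ capConst C b c * (D ^ 2 / ε ^ 2 * x ^ 5 * k) := by
  have hℓ0 : 0 < Real.log (1 + 1 / (2 * C)) := Real.log_pos (by
    have : 0 < 1 / (2 * C) := by positivity
    linarith)
  unfold capConst
  set ℓ := Real.log (1 + 1 / (2 * C))
  have hx0 : 0 < x := by linarith
  have hk0 : 0 < k := by linarith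
  have hxx : 1 ≤ 4 * x ^ 2 := by nlinarith
  have hxk : 1 ≤ 4 * (x * k) := by nlinarith
  have hxxk : 1 ≤ 8 * (x ^ 2 * k) := by nlinarith
  have hB : 1 + 3 * x * (3 * (D * ((2 * b + 8) * x + 2 * k) / ℓ)) ≤
      (8 + 9 * (4 * b + 20) / ℓ) * (D * x ^ 2 * k) := by
    have h1 : (2 * b + 8) * x + 2 * k ≤ (4 * b + 20) * (x * k) := by
      have h2 : (0 : ℝ) ≤ (2 * b + 8) * x * (2 * k - 1) :=
        mul_nonneg (by positivity) (by linarith)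
      have h3 : (0 : ℝ) ≤ 2 * k * (2 * x - 1) := mul_nonneg (by positivity) (by linarith)
      nlinarith
    have h2 : 1 ≤ 8 * (D * x ^ 2 * k) := by nlinarith
    calc 1 + 3 * x * (3 * (D * ((2 * b + 8) * x + 2 * k) / ℓ))
        ≤ 8 * (D * x ^ 2 * k) + 3 * x * (3 * (D * ((4 * b + 20) * (x * k)) / ℓ)) := by gcongr
      _ = _ := by ring
  set b₁ := 8 + 9 * (4 * b + 20) / ℓ with hb₁
  have hb₁0 : 0 ≤ b₁ := by positivity
  have h4 : 4 * C * (1 + 3 * x * (3 * (D * ((2 * b + 8) * x + 2 * k) / ℓ))) + 1 ≤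
      (4 * C * b₁ + 8) * (D * x ^ 2 * k) := by
    have h2 : 1 ≤ 8 * (D * x ^ 2 * k) := by nlinarith
    calc _ ≤ 4 * C * (b₁ * (D * x ^ 2 * k)) + 8 * (D * x ^ 2 * k) := by gcongr
      _ = _ := by ring
  have hDε : 1 ≤ D / ε ^ 2 := by
    rw [one_le_div (by positivity)]
    have : ε ^ 2 ≤ 1 := pow_le_one₀ hε0.le hε1
    linarith
  have hDDε : 1 ≤ D ^ 2 / ε ^ 2 := by
    have : D ^ 2 / ε ^ 2 = D * (D / ε ^ 2) := by ring
    nlinarith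
  have hQ : 0 ≤ D ^ 2 / ε ^ 2 * x ^ 3 * k := by positivity
  have h5 : 1 ≤ 16 * (D ^ 2 / ε ^ 2 * x ^ 3 * k) := by
    have h6 : 1 ≤ 16 * (x ^ 3 * k) := by nlinarith
    nlinarith
  have h6 : D * x ≤ 8 * (D ^ 2 / ε ^ 2 * x ^ 3 * k) := by
    have h7 : D ^ 2 / ε ^ 2 * x ^ 3 * k = (D * x) * (D / ε ^ 2 * (x ^ 2 * k)) := by ring
    have h8 : 1 ≤ D / ε ^ 2 * (8 * (x ^ 2 * k)) := by nlinarith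
    have h9 : 0 < D * x := by positivity
    rw [h7]; nlinarith
  have h7 : D ^ 2 / ε ^ 2 * x ^ 3 * k ≤ 4 * (D ^ 2 / ε ^ 2 * x ^ 5 * k) := by
    have : D ^ 2 / ε ^ 2 * x ^ 5 * k = D ^ 2 / ε ^ 2 * x ^ 3 * k * x ^ 2 := by ring
    rw [this]; nlinarith
  calc _ ≤ 2 * (1 + (4 * C * b₁ + 8) * (D * x ^ 2 * k) /
        (ε ^ 2 / (256 * C * ((c + 10) * D * x)))) + (c + 10) * D * x := by gcongr
    _ = 2 + 512 * (4 * C * b₁ + 8) * C * (c + 10) * (D ^ 2 / ε ^ 2 * x ^ 3 * k) +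
        (c + 10) * (D * x) := by field_simp; ring
    _ ≤ 2 * (16 * (D ^ 2 / ε ^ 2 * x ^ 3 * k)) +
        512 * (4 * C * b₁ + 8) * C * (c + 10) * (D ^ 2 / ε ^ 2 * x ^ 3 * k) +
        (c + 10) * (8 * (D ^ 2 / ε ^ 2 * x ^ 3 * k)) := by gcongr; linarith
    _ = (32 + 512 * (4 * C * b₁ + 8) * C * (c + 10) + 8 * (c + 10)) *
        (D ^ 2 / ε ^ 2 * x ^ 3 * k) := by ring
    _ ≤ (32 + 512 * (4 * C * b₁ + 8) * C * (c + 10) + 8 * (c + 10)) *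
        (4 * (D ^ 2 / ε ^ 2 * x ^ 5 * k)) := by gcongr
    _ = _ := by ring

theorem half_le_log {a : ℝ} (ha : 2 ≤ a) : 1 / 2 ≤ Real.log a := by
  have h1 := Real.log_le_log two_pos ha
  have h2 := Real.log_two_gt_d9
  linarith

/-- The sampler is chosen before `W`: accuracy on every suffix covers every window length. -/
theorem exists_sampler {G : ℝ → ℝ} {C : ℝ} (hG : IsOrliczFunction G C) (b c : ℕ) {n d : ℕ}
    {ε κ : ℝ} (hn : 4 ≤ n) (hd : 1 ≤ d) (hdn : d ≤ n) (hε0 : 0 < ε) (hε : ε ≤ 1 / 2)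
    (hεn : 1 / ε ≤ n) (hκ : 2 ≤ κ) :
    ∃ alg : RowSampler d, ∀ (W m : ℕ) (r : ℕ → Fin d → ℤ), m ≤ n →
      (∀ i < m, ∀ k, |r i k| ≤ (n : ℤ) ^ b) → StreamConditionNumberLE r m κ →
      ENNReal.ofReal (1 - 1 / (n : ℝ) ^ c) ≤ (alg.run r m).toOuterMeasure
        {p | (p.2 : ℝ) ≤
            capConst C b c * ((d : ℝ) ^ 2 / ε ^ 2 * Real.log n ^ 5 * Real.log κ) ∧
          IsSubspaceEmbedding G ε (output W m p.1) (windowMatrix r W m)} := by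
  classical
  have hC := hG.one_le_const
  have hn2 : (2 : ℝ) ≤ n := by exact_mod_cast (by omega : 2 ≤ n)
  have hx := half_le_log hn2
  have hk := half_le_log hκ
  have hd' : (1 : ℝ) ≤ d := by exact_mod_cast hd
  have hcap := cap_bound hC b c hd' hx hk hε0 (by linarith)
  set L := ((c : ℝ) + 10) * d * Real.log n with hL
  have hL0 : 0 < L := by positivity
  -- Chosen so that the deviation exponent for `η = ε / 4` is exactly `-L`; `cap` likewise makes the
  -- overflow term `exp (-L)`.
  set γ := ε ^ 2 / (256 * C * L) with hγ
  have hγ0 : 0 < γ := by positivity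
  set B := 1 + 3 * Real.log n * (3 * (d * ((2 * b + 8) * Real.log n + 2 * Real.log κ) /
    Real.log (1 + 1 / (2 * C)))) with hB
  have hB0 : 0 ≤ B := by
    have : 0 ≤ Real.log (1 + 1 / (2 * C)) := Real.log_nonneg (by
      have : 0 < 1 / (2 * C) := by positivity
      linarith)
    have : 0 ≤ Real.log κ := by linarith
    positivity
  set cap := 2 * (1 + (4 * C * B + 1) / γ) + L with hcapdef
  have hcap0 : 0 ≤ cap := by positivity
  refine ⟨thinningSampler (sensTarget G γ n), fun W m r hm hr hcond => ?_⟩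
  set bad : ℕ → Memory d → ℝ := fun t S => if S.Accurate G ε cap r t then 0 else 1 with hbad
  have hbad_le : ∀ u ≤ m,
      killedExp (sensTarget G γ n) r (Memory.Accurate G ε cap r) u (bad u) ≤
        n * (1 + 8 / ε) ^ d * (2 * Real.exp (-L)) + Real.exp (-L) := by
    intro u hu
    have hsum := sum_blockSens_le hG r (n := n) (b := b) (t := u - 1) (κ := κ) (by omega) hdn
      (by omega) (fun i hi => hr i (by omega)) hκ (fun i hi => hcond i (u - 1) hi (by omega))
    have h := killedExp_not_accurate_le (cap := cap) r hG hγ0 (by omega : 0 < n) hε0 hε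
      (by omega : u ≤ n) hB0 hsum
    have h1 : -(ε / 4) ^ 2 / (4 * (4 * C * γ)) = -L := by
      rw [hγ]; field_simp; ring
    have h2 : 2 * (1 + (4 * C * B + 1) / γ) - cap = -L := by rw [hcapdef]; ring
    rw [h1, h2] at h
    exact h
  have hrun := tsum_run_le_killedExp (sensTarget G γ n) r (Memory.Accurate G ε cap r) hcap0
    (fun t S h => h.1) m (bad m) (fun S => by simp only [hbad]; split_ifs <;> norm_num)
    (fun S => by simp only [hbad]; split_ifs <;> norm_num)
    (fun S hS => by
      simp only [hbad]
      rw [if_neg fun h : S.Accurate G ε cap r m => absurd h.1 (not_le.2 hS)])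
  refine PMF.ofReal_one_sub_le_toOuterMeasure _ _ _ (fun p hp => ?_) (by positivity)
    (hrun.trans (ENNReal.ofReal_le_ofReal ?_))
  · rw [Set.mem_ofPred_eq, not_and_or, not_le] at hp
    split_ifs with hpc
    · simp
    · have hna : ¬ p.1.Accurate G ε cap r m := by
        intro hacc
        rcases hp with hp | hp
        · exact hpc (hcap.trans_lt hp)
        · refine hp ?_
          rw [output_eq_since]
          exact hacc.2 _
      simp only [hbad, if_neg hna]
      simp
  -- The final state is one more possible time of first failure, so `m + 1` times are summed.
  · rw [add_comm, ← Finset.sum_range_succ (fun u =>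
      killedExp (sensTarget G γ n) r (Memory.Accurate G ε cap r) u (bad u))]
    refine (Finset.sum_le_card_nsmul _ _ _ fun u hu =>
      hbad_le u (Nat.lt_succ_iff.1 (Finset.mem_range.1 hu))).trans ?_
    rw [Finset.card_range, nsmul_eq_mul]
    refine le_trans ?_ (failure_bound (c := c) hn hd hε0 hεn)
    have : ((m + 1 : ℕ) : ℝ) ≤ n + 1 := by exact_mod_cast Nat.succ_le_succ hm
    gcongr

theorem IsAspectBound.one_le {ι : Type*} [Fintype ι] {d : ℕ} {G : ℝ → ℝ} {C : ℝ}
    (hG : IsOrliczFunction G C) {A : Matrix ι (Fin d) ℝ} {ε Δ : ℝ} (h : IsAspectBound G A ε Δ) :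
    1 ≤ Δ := by
  obtain ⟨_, Δ₁, Δ₂, -, h1, h2, -, h3⟩ := h
  exact (hG.one_le_ratio h1 h2).trans h3

theorem mainTheorem5 (C : ℝ) (b c : ℕ) :
    ∃ K : ℝ, 0 < K ∧
      ∀ (n d W : ℕ) (ε κ Δ : ℝ) (G : ℝ → ℝ),
        2 ≤ n → 1 ≤ W → 0 < ε → 2 ≤ κ → IsOrliczFunction G C →
        ∃ alg : RowSampler d,
          ∀ (m : ℕ) (r : ℕ → Fin d → ℤ), m ≤ n →
            (∀ i < m, ∀ k, |r i k| ≤ (n : ℤ) ^ b) →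
            StreamConditionNumberLE r m κ →
            IsAspectBound G (windowMatrix r W m) ε Δ →
            ENNReal.ofReal (1 - 1 / (n : ℝ) ^ c) ≤
              (alg.run r m).toOuterMeasure
                {p : Memory d × ℕ |
                  (p.2 : ℝ) ≤ K * ((d : ℝ) ^ 2 * Δ / ε ^ 2 * Real.log n ^ 5 * Real.log κ) ∧
                  IsSubspaceEmbedding G ε (output W m p.1) (windowMatrix r W m)} := by
  refine ⟨4 * |capConst C b c| + 256, by positivity, ?_⟩
  intro n d W ε κ Δ G hn hW hε hκ hG
  set K := 4 * |capConst C b c| + 256 with hK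
  have hn2 : (2 : ℝ) ≤ n := by exact_mod_cast hn
  have hx := half_le_log hn2
  have hk := half_le_log hκ
  have hx0 : 0 < Real.log n := by linarith
  have hk0 : 0 < Real.log κ := by linarith
  have hle1 : ENNReal.ofReal (1 - 1 / (n : ℝ) ^ c) ≤ 1 := by
    rw [ENNReal.ofReal_le_one]
    have : 0 ≤ 1 / (n : ℝ) ^ c := by positivity
    linarith
  -- The zero sample has error equal to the norm itself, which is allowed for `ε ≥ 1` and vanishes
  -- for `d = 0`.
  by_cases htriv : 1 ≤ ε ∨ d = 0
  · refine ⟨emptySampler d, fun m r hm hr hcond hΔ => ?_⟩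
    have hΔ1 := hΔ.one_le hG
    rw [emptySampler_run, PMF.toOuterMeasure_pure_of_mem]
    · exact hle1
    refine ⟨?_, fun x => ?_⟩
    · simp only [Nat.cast_zero]; positivity
    · have h0 : output W m (∅ : Memory d) = ∅ := rfl
      have hp := blockNorm_nonneg hG r (m - W) m x
      rw [h0, sampleNorm_empty, zero_sub, abs_neg, abs_of_nonneg hp]
      rcases htriv with h | rfl
      · nlinarith
      · have : windowMatrix r W m *ᵥ x = 0 := by
          ext t; simp [mulVec, dotProduct]
        rw [this, orliczNorm_eq_weighted, hG.weightedOrliczNorm_zero, mul_zero]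
  push Not at htriv
  obtain ⟨hε1, hd0⟩ := htriv
  have hd1 : 1 ≤ d := Nat.one_le_iff_ne_zero.2 hd0
  have hd1' : (1 : ℝ) ≤ d := by exact_mod_cast hd1
  -- The sampler needs accuracy at most `1/2`; since `ε < 1`, the replacement costs at most a factor
  -- `4` in `1 / ε²`.
  set e := min ε (1 / 2) with he
  have he0 : 0 < e := lt_min hε (by norm_num)
  have he2 : e ≤ 1 / 2 := min_le_right _ _
  have heε : ε / 2 ≤ e := le_min (by linarith) (by linarith)
  have hsq : (d : ℝ) ^ 2 / e ^ 2 ≤ 4 * ((d : ℝ) ^ 2 / ε ^ 2) := by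
    have h1 : (ε / 2) ^ 2 ≤ e ^ 2 := pow_le_pow_left₀ (by positivity) heε 2
    calc (d : ℝ) ^ 2 / e ^ 2 ≤ (d : ℝ) ^ 2 / (ε / 2) ^ 2 := by gcongr
      _ = _ := by field_simp; norm_num
  -- In this regime all rows fit into memory. Otherwise `d ≤ n`, `1 / e ≤ n` and `n ≥ 4`, as the
  -- sampler requires.
  by_cases hbig : (n : ℝ) ≤ (d : ℝ) ^ 2 / e ^ 2
  · refine ⟨storeAllSampler d, fun m r hm hr hcond hΔ => ?_⟩
    have hΔ1 := hΔ.one_le hG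
    rw [storeAllSampler_run, PMF.toOuterMeasure_pure_of_mem]
    · exact hle1
    refine ⟨?_, fun x => ?_⟩
    · simp only
      have hm' : (m : ℝ) ≤ n := by exact_mod_cast hm
      have h1 : 1 ≤ 64 * (Real.log n ^ 5 * Real.log κ) := by
        have h2 : (1 / 2) ^ 5 * (1 / 2) ≤ Real.log n ^ 5 * Real.log κ := by gcongr
        norm_num at h2 ⊢
        linarith
      have h3 : 0 ≤ (d : ℝ) ^ 2 / ε ^ 2 := by positivity
      calc (m : ℝ) ≤ 4 * ((d : ℝ) ^ 2 / ε ^ 2) := hm'.trans (hbig.trans hsq)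
        _ ≤ 4 * ((d : ℝ) ^ 2 / ε ^ 2) * (64 * (Real.log n ^ 5 * Real.log κ)) :=
          le_mul_of_one_le_right (by positivity) h1
        _ = 256 * ((d : ℝ) ^ 2 * 1 / ε ^ 2 * Real.log n ^ 5 * Real.log κ) := by ring
        _ ≤ K * ((d : ℝ) ^ 2 * Δ / ε ^ 2 * Real.log n ^ 5 * Real.log κ) := by
          have : 256 ≤ K := by rw [hK]; linarith [abs_nonneg (capConst C b c)]
          gcongr
    · rw [output_eq_since, sampleNorm_fullMemory hG, sub_self, abs_zero]
      exact mul_nonneg hε.le (blockNorm_nonneg hG r (m - W) m x)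
  · rw [not_le] at hbig
    have he1 : 1 ≤ 1 / e ^ 2 := by
      rw [one_le_div (by positivity)]
      exact pow_le_one₀ he0.le (by linarith)
    have hee : 1 / e ≤ 1 / e ^ 2 := by
      refine one_div_le_one_div_of_le (by positivity) ?_
      nlinarith
    have hdd : (d : ℝ) ≤ (d : ℝ) ^ 2 := by nlinarith
    have hdiv : (d : ℝ) ^ 2 / e ^ 2 = (d : ℝ) ^ 2 * (1 / e ^ 2) := by ring
    rw [hdiv] at hbig
    have hdn : d ≤ n := by
      have : (d : ℝ) ≤ n := by nlinarith
      exact_mod_cast this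
    have hen : 1 / e ≤ n := by nlinarith
    have hn4 : 4 ≤ n := by
      have h4 : 4 ≤ 1 / e ^ 2 := by
        rw [le_div_iff₀ (by positivity)]; nlinarith
      have : (4 : ℝ) ≤ n := by nlinarith
      exact_mod_cast this
    obtain ⟨alg, halg⟩ := exists_sampler hG b c hn4 hd1 hdn he0 he2 hen hκ
    refine ⟨alg, fun m r hm hr hcond hΔ => (halg W m r hm hr hcond).trans ?_⟩
    have hΔ1 := hΔ.one_le hG
    refine MeasureTheory.measure_mono fun p hp => ⟨hp.1.trans ?_, fun x => ?_⟩
    · calc capConst C b c * ((d : ℝ) ^ 2 / e ^ 2 * Real.log n ^ 5 * Real.log κ)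
          ≤ |capConst C b c| * (4 * ((d : ℝ) ^ 2 / ε ^ 2) * Real.log n ^ 5 * Real.log κ) := by
            gcongr
            exact le_abs_self _
        _ = 4 * |capConst C b c| * ((d : ℝ) ^ 2 * 1 / ε ^ 2 * Real.log n ^ 5 * Real.log κ) := by
            ring
        _ ≤ K * ((d : ℝ) ^ 2 * Δ / ε ^ 2 * Real.log n ^ 5 * Real.log κ) := by
            have : 4 * |capConst C b c| ≤ K := by rw [hK]; linarith
            gcongr
    · refine (hp.2 x).trans ?_
      exact mul_le_mul_of_nonneg_right (min_le_left _ _) (blockNorm_nonneg hG r (m - W) m x)
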